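/- Multigraphs here are finite and may have loops and multiple edges. A cycle in a multigraph is a closed sequence of $n \ge 1$ distinct vertices joined cyclically by $n$ distinct edges; in particular a loop is a cycle of length $1$ and two parallel edges between distinct vertices form a cycle of length $2$. Cycles are disjoint if they have no common vertex. For a vertex $v$ of a multigraph $G$, let $s(v)$ be the number of vertices other than $v$ that are adjacent to $v$. Let $V_1$ be the set of vertices of $G$ that are incident to a loop, let $F$ be the simple graph on $V(G)\setminus V_1$ in which two distinct vertices are adjacent if and only if they are joined by at least two edges of $G$, and let $\alpha'$ be the maximum number of edges in a matching of $F$. **Theorem.** Let $k \ge 1$ be an integer and let $G$ be a multigraph such that $s(v) \ge 2k$ for every vertex $v$ of $G$. Then $G$ does not contain $k$ pairwise disjoint cycles if and only if $$|V(G)| - |V_1| - 2\alpha' < 3\,(k - |V_1| - \alpha'),$$ that is, if and only if $|V(G)| + 2|V_1| + \alpha' < 3k$. -/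

import Mathlib

namespace Graph

variable {α β : Type*}

/-- The set `V₁(G)` of vertices incident to a loop. -/
def loopVertices (G : Graph α β) : Set α :=
  {v | ∃ e, G.IsLoopAt e v}

/-- The simple degree of `v`: the number of distinct neighbours of `v`, that is, the degree of `v`
in the underlying simple graph (a loop at `v` does not make `v` a neighbour of itself). -/
noncomputable def simpleDegree (G : Graph α β) (v : α) : ℕ :=
  {w | w ≠ v ∧ G.Adj v w}.ncard

/-- The simple graph formed by the multiple edges of `G`: distinct `x`, `y` are adjacent when at
least two edges of `G` join them. Vertices without multiple edges are isolated in it, which has no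
effect on its matchings. -/
def multipleEdgeGraph (G : Graph α β) : SimpleGraph α where
  Adj x y := x ≠ y ∧ ∃ e f, e ≠ f ∧ G.IsLink e x y ∧ G.IsLink f x y
  symm := ⟨fun _ _ ⟨hxy, e, f, hef, he, hf⟩ => ⟨hxy.symm, e, f, hef, he.symm, hf.symm⟩⟩
  loopless := ⟨fun _ h => h.1 rfl⟩

/-- The graph `F(G)` of strong edges: the simple graph formed by the multiple edges of
`G - V₁(G)`. -/
def strongGraph (G : Graph α β) : SimpleGraph α :=
  (G.deleteVerts G.loopVertices).multipleEdgeGraph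

/-- A cycle of length `length ≥ 1` in a multigraph: distinct vertices and distinct edges, the
`i`-th edge joining the `i`-th vertex to the next one, with indices modulo `length`. Length one is
a loop, length two is a pair of parallel edges. -/
structure Cycle (G : Graph α β) where
  length : ℕ
  [length_ne_zero : NeZero length]
  vert : Fin length → α
  edge : Fin length → β
  vert_injective : Function.Injective vert
  edge_injective : Function.Injective edge
  isLink : ∀ i : Fin length, G.IsLink (edge i) (vert i) (vert (i + 1))

/-- `G` contains `k` pairwise vertex-disjoint cycles. -/
def HasDisjointCycles (G : Graph α β) (k : ℕ) : Prop :=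
  ∃ C : Fin k → G.Cycle,
    Pairwise fun i j => Disjoint (Set.range (C i).vert) (Set.range (C j).vert)

end Graph

/-- The matching number of a simple graph whose matchings have bounded size: the largest number of
edges in a matching. -/
noncomputable def SimpleGraph.matchingNumber {α : Type*} (F : SimpleGraph α) : ℕ :=
  sSup {n | ∃ M : F.Subgraph, M.IsMatching ∧ M.edgeSet.Finite ∧ M.edgeSet.ncard = n}

/-! The inequality is a count. Given `k` disjoint cycles, weigh each by its length, plus 2 if it
meets $V_1$, plus 1 if it has length two and avoids $V_1$. Every weight is at least 3, while the
three contributions total at most $|V|$, $2|V_1|$ and $\alpha'$ (`Graph.HasDisjointCycles.le`).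
Conversely, loops and a maximum matching of strong edges give $|V_1| + \alpha'$ cycles. They use at
most $|V_1| + 2\alpha'$ vertices, so with $m = k - |V_1| - \alpha'$ the remainder keeps at least
$3m$ vertices and simple degrees at least $2m$, and the Corrádi–Hajnal theorem supplies the missing
cycles (`Graph.hasDisjointCycles_of_le`).

Corrádi–Hajnal (`SimpleGraph.exists_isPacking`) is proved for cores, which are easier to exchange
than cycles and always contain one (`SimpleGraph.IsCore.exists_cyclic_sequence`). Adding an edge and
inducting reduces it to this: `k - 1` disjoint cores leaving at least three vertices uncovered can
be improved. Choose them so that the uncovered set $R$ is largest and then spans the most edges. If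
$R$ has no core it is a forest. Exchanging a vertex of $R$ with one of a triangle cannot add edges
to $R$, which limits the edges from $R$ to each triangle (`blocked`). Comparing degree sums with
these limits makes $R$ a path $apb$ and then excludes the path
(`SimpleGraph.IsOptimal.exists_isCore`). -/

/-! ### Boolean inequalities for edges into a triangle. -/

/-- For indicator functions `a`, `b`, `d` of subsets of a three-element set: no element lies in both
of the last two subsets while the two other elements lie in the first. -/
def blocked (a₁ a₂ a₃ b₁ b₂ b₃ d₁ d₂ d₃ : Bool) : Bool :=
  !(a₂ && a₃ && b₁ && d₁) && !(a₁ && a₃ && b₂ && d₂) && !(a₁ && a₂ && b₃ && d₃)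

/-- Each row records the neighbours of one uncovered vertex in a triangle of the packing. An average
of two per row is the threshold: degree `2k` spread over `k - 1` cores leaves two neighbours to be
found in the rest. -/
theorem sum_le_six_of_blocked : ∀ a₁ a₂ a₃ b₁ b₂ b₃ d₁ d₂ d₃ : Bool,
    blocked a₁ a₂ a₃ b₁ b₂ b₃ d₁ d₂ d₃ → blocked b₁ b₂ b₃ a₁ a₂ a₃ d₁ d₂ d₃ →
    blocked d₁ d₂ d₃ a₁ a₂ a₃ b₁ b₂ b₃ →
    (a₁.toNat + a₂.toNat + a₃.toNat) + (b₁.toNat + b₂.toNat + b₃.toNat)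
      + (d₁.toNat + d₂.toNat + d₃.toNat) ≤ 6 := by
  decide

/-- Rows `a`, `b` belong to the ends of the rest, `p`, `q` to vertices with two neighbours in it.
The latter are blocked only by three common neighbours, hence the conjunctions. Hypotheses precede
further quantifiers so that `decide` drops failing branches early. -/
theorem sum_le_eight_of_blocked : ∀ a₁ a₂ a₃ b₁ b₂ b₃ p₁ p₂ p₃ : Bool,
    blocked a₁ a₂ a₃ b₁ b₂ b₃ p₁ p₂ p₃ → blocked b₁ b₂ b₃ a₁ a₂ a₃ p₁ p₂ p₃ →
    ∀ q₁ q₂ q₃ : Bool, blocked a₁ a₂ a₃ b₁ b₂ b₃ q₁ q₂ q₃ → blocked b₁ b₂ b₃ a₁ a₂ a₃ q₁ q₂ q₃ →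
    blocked a₁ a₂ a₃ p₁ p₂ p₃ q₁ q₂ q₃ → blocked b₁ b₂ b₃ p₁ p₂ p₃ q₁ q₂ q₃ →
    blocked p₁ p₂ p₃ (a₁ && b₁) (a₂ && b₂) (a₃ && b₃) q₁ q₂ q₃ →
    blocked q₁ q₂ q₃ (a₁ && b₁) (a₂ && b₂) (a₃ && b₃) p₁ p₂ p₃ →
    (a₁.toNat + a₂.toNat + a₃.toNat) + (b₁.toNat + b₂.toNat + b₃.toNat)
      + (p₁.toNat + p₂.toNat + p₃.toNat) + (q₁.toNat + q₂.toNat + q₃.toNat) ≤ 8 := by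
  decide

-- Three packings are combined, with rests the paths `a p b`, `c b p` and `d a p`; the two ends of
-- each path are blocked. Here `c` and `d` are triangle vertices that entered the rest in exchange
-- for `a` and `b`.
set_option maxRecDepth 10000 in
set_option synthInstance.maxHeartbeats 400000 in
set_option synthInstance.maxSize 2000 in
theorem sum_le_twelve_of_blocked : ∀ a₁ a₂ a₃ b₁ b₂ b₃ p₁ p₂ p₃ : Bool,
    blocked a₁ a₂ a₃ b₁ b₂ b₃ p₁ p₂ p₃ → blocked b₁ b₂ b₃ a₁ a₂ a₃ p₁ p₂ p₃ →
    ∀ c₁ c₂ c₃ : Bool, blocked c₁ c₂ c₃ b₁ b₂ b₃ p₁ p₂ p₃ → blocked p₁ p₂ p₃ b₁ b₂ b₃ c₁ c₂ c₃ →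
    ∀ d₁ d₂ d₃ : Bool, blocked d₁ d₂ d₃ a₁ a₂ a₃ p₁ p₂ p₃ → blocked p₁ p₂ p₃ a₁ a₂ a₃ d₁ d₂ d₃ →
    (a₁.toNat + a₂.toNat + a₃.toNat) + (b₁.toNat + b₂.toNat + b₃.toNat)
      + (c₁.toNat + c₂.toNat + c₃.toNat) + (d₁.toNat + d₂.toNat + d₃.toNat)
      + 2 * (p₁.toNat + p₂.toNat + p₃.toNat) ≤ 12 := by
  decide

/-! ### Cores and edge counts. -/

namespace SimpleGraph

section Core

open Finset
open scoped Classical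

variable {V : Type*} (G : SimpleGraph V)

/-- The number of neighbours of `v` in `S`. -/
noncomputable def degIn (S : Finset V) (v : V) : ℕ := #{w ∈ S | G.Adj v w}

/-- The sum of the degrees of the subgraph induced by `S`. -/
noncomputable def degSum (S : Finset V) : ℕ := ∑ v ∈ S, G.degIn S v

/-- A nonempty set of vertices inducing a subgraph of minimum degree at least two. -/
def IsCore (S : Finset V) : Prop := S.Nonempty ∧ ∀ v ∈ S, 2 ≤ G.degIn S v

variable {G} {S T : Finset V} {u v w x : V}

theorem degIn_insert (hv : v ∉ S) :
    G.degIn (insert v S) u = G.degIn S u + if G.Adj u v then 1 else 0 := by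
  simp only [degIn, card_filter, sum_insert hv]
  ring

theorem degIn_erase_add (hv : v ∈ S) :
    G.degIn (S.erase v) u + (if G.Adj u v then 1 else 0) = G.degIn S u := by
  simp only [degIn, card_filter]
  exact sum_erase_add _ _ hv

theorem degIn_erase_self : G.degIn (S.erase v) v = G.degIn S v := by
  by_cases hv : v ∈ S
  · simpa using degIn_erase_add (G := G) (u := v) hv
  · rw [erase_eq_of_notMem hv]

theorem degIn_mono_left {H : SimpleGraph V} (h : G ≤ H) : G.degIn S v ≤ H.degIn S v :=
  card_le_card (monotone_filter_right _ fun _ _ hw => h hw)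

theorem degIn_le_card : G.degIn S v ≤ #S := card_filter_le _ _

theorem degIn_lt_card (hv : v ∈ S) : G.degIn S v < #S := by
  rw [← degIn_erase_self]
  exact degIn_le_card.trans_lt (card_erase_lt_of_mem hv)

theorem card_le_degIn (h : T ⊆ S) (hT : ∀ w ∈ T, G.Adj v w) : #T ≤ G.degIn S v :=
  card_le_card fun w hw => mem_filter.2 ⟨h hw, hT w hw⟩

theorem degIn_erase_of_degIn_eq_zero (h : G.degIn S u = 0) (hv : v ∈ S) :
    G.degIn (S.erase u) v = G.degIn S v := by
  by_cases hu : u ∈ S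
  · rw [← degIn_erase_add hu, if_neg, add_zero]
    intro huv
    have := card_le_degIn (G := G) (v := u) (singleton_subset_iff.2 hv) (by simpa using huv.symm)
    simp [h] at this
  · rw [erase_eq_of_notMem hu]

theorem degIn_union (h : Disjoint S T) : G.degIn (S ∪ T) v = G.degIn S v + G.degIn T v := by
  simp only [degIn, card_filter, sum_union h]

theorem degSum_insert (hv : v ∉ S) :
    G.degSum (insert v S) = G.degSum S + 2 * G.degIn S v := by
  have h1 : G.degIn (insert v S) v = G.degIn S v := by simp [degIn_insert hv]
  have h2 : ∑ u ∈ S, G.degIn (insert v S) u = G.degSum S + G.degIn S v := by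
    rw [sum_congr rfl fun u _ => degIn_insert (G := G) (u := u) hv, sum_add_distrib]
    simp only [degSum, degIn, card_filter, G.adj_comm v]
  rw [degSum, sum_insert hv, h1, h2]
  ring

theorem degSum_erase_add (hv : v ∈ S) :
    G.degSum (S.erase v) + 2 * G.degIn S v = G.degSum S := by
  conv_rhs => rw [← insert_erase hv, degSum_insert (notMem_erase v S), degIn_erase_self]

theorem IsCore.three_le_card (h : G.IsCore S) : 3 ≤ #S := by
  obtain ⟨v, hv⟩ := h.1
  have := h.2 v hv
  have := degIn_lt_card (G := G) hv
  omega

theorem isCore_triple {a b c : V} (hab : G.Adj a b) (hac : G.Adj a c) (hbc : G.Adj b c) :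
    G.IsCore {a, b, c} := by
  refine ⟨by simp, ?_⟩
  have aux : ∀ x y z : V, y ≠ z → G.Adj x y → G.Adj x z → y ∈ ({a, b, c} : Finset V) →
      z ∈ ({a, b, c} : Finset V) → 2 ≤ G.degIn {a, b, c} x := by
    intro x y z hyz hxy hxz hy hz
    rw [← card_pair hyz]
    refine card_le_degIn ?_ ?_
    · intro t ht
      simp only [mem_insert, mem_singleton] at ht
      rcases ht with rfl | rfl <;> assumption
    · intro t ht
      simp only [mem_insert, mem_singleton] at ht
      rcases ht with rfl | rfl <;> assumption
  intro v hv
  simp only [mem_insert, mem_singleton] at hv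
  rcases hv with rfl | rfl | rfl
  · exact aux _ b c hbc.ne hab hac (by simp) (by simp)
  · exact aux _ a c hac.ne hab.symm hbc (by simp) (by simp)
  · exact aux _ a b hab.ne hac.symm hbc.symm (by simp) (by simp)

/-- A graph with at least as many edges as vertices contains a core. -/
theorem exists_isCore_of_le_degSum (S : Finset V) (hS : S.Nonempty) (h : 2 * #S ≤ G.degSum S + 1) :
    ∃ T ⊆ S, G.IsCore T := by
  induction S using Finset.strongInduction with
  | H S ih =>
    by_cases hdeg : ∀ v ∈ S, 2 ≤ G.degIn S v
    · exact ⟨S, subset_rfl, hS, hdeg⟩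
    push Not at hdeg
    obtain ⟨v, hv, hlt⟩ := hdeg
    have h1 := degSum_erase_add (G := G) hv
    have h2 := card_erase_add_one hv
    have h5 := degIn_lt_card (G := G) hv
    -- Erasing `v` lowers `2 * #S` by two and the degree sum by at most two. A single vertex has
    -- degree sum zero, so the inequality excludes it.
    obtain ⟨T, hT, hc⟩ := ih (S.erase v) (erase_ssubset hv) (by
      rw [← card_pos]
      by_contra h0
      have h3 : S.erase v = ∅ := by rw [← card_eq_zero]; omega
      have h4 : G.degSum (S.erase v) = 0 := by rw [h3]; rfl
      omega) (by omega)
    exact ⟨T, hT.trans (erase_subset _ _), hc⟩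

/-- The edge bound for a nonempty forest; the `+ 1` in `exists_isCore_of_le_degSum` is what gains
the full two. -/
theorem degSum_add_two_le_of_forall_not_isCore (hS : S.Nonempty) (h : ∀ T ⊆ S, ¬ G.IsCore T) :
    G.degSum S + 2 ≤ 2 * #S := by
  by_contra h1
  obtain ⟨T, hT, hc⟩ := exists_isCore_of_le_degSum (G := G) S hS (by omega)
  exact h T hT hc

/-- Removing any vertex leaves a forest. That forest has a vertex of degree at most one, so some `x`
has degree exactly two in `S`; removing this `x` bounds the degree sum of `S` by `2 * #S`, which
forces equality everywhere. -/
theorem IsCore.degIn_eq_two (hS : G.IsCore S) (hmin : ∀ T ⊂ S, ¬ G.IsCore T) :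
    ∀ v ∈ S, G.degIn S v = 2 := by
  have hcard := hS.three_le_card
  have key : ∀ x ∈ S, (S.erase x).Nonempty ∧ G.degSum (S.erase x) + 2 ≤ 2 * #(S.erase x) := by
    intro x hx
    have hne : (S.erase x).Nonempty := by
      rw [← card_pos, card_erase_of_mem hx]; omega
    exact ⟨hne, degSum_add_two_le_of_forall_not_isCore hne
      fun T hT => hmin T (hT.trans_ssubset (erase_ssubset hx))⟩
  obtain ⟨x, hx, hx2⟩ : ∃ x ∈ S, G.degIn S x = 2 := by
    obtain ⟨z, hz⟩ := hS.1
    obtain ⟨hne, hlt⟩ := key z hz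
    obtain ⟨x, hx, hlt⟩ : ∃ x ∈ S.erase z, G.degIn (S.erase z) x < 2 := by
      by_contra! hcon
      have : #(S.erase z) * 2 ≤ G.degSum (S.erase z) := card_nsmul_le_sum _ _ 2 hcon
      omega
    have h1 := degIn_erase_add (G := G) (u := x) hz
    have h2 := hS.2 x (mem_of_mem_erase hx)
    refine ⟨x, mem_of_mem_erase hx, ?_⟩
    split_ifs at h1 <;> omega
  obtain ⟨-, hlt⟩ := key x hx
  have h1 := degSum_erase_add (G := G) hx
  have h2 := card_erase_add_one hx
  have hle : ∑ v ∈ S, G.degIn S v ≤ ∑ v ∈ S, 2 := by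
    rw [sum_const, smul_eq_mul]
    change G.degSum S ≤ _
    omega
  have heq := le_antisymm (sum_le_sum hS.2) hle
  intro v hv
  exact ((sum_eq_sum_iff_of_le hS.2).1 heq v hv).symm

theorem degIn_triple {a b c : V} (hab : a ≠ b) (hac : a ≠ c) (hbc : b ≠ c) :
    G.degIn {a, b, c} v = (decide (G.Adj v a)).toNat + (decide (G.Adj v b)).toNat
      + (decide (G.Adj v c)).toNat := by
  have h (x : V) : (decide (G.Adj v x)).toNat = if G.Adj v x then 1 else 0 := by
    by_cases h : G.Adj v x <;> simp [h]
  simp only [degIn, card_filter, h]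
  rw [sum_insert (by simp [hab, hac]), sum_insert (by simp [hbc]), sum_singleton, add_assoc]

theorem IsCore.adj_of_card_eq_three (hS : G.IsCore S) (h3 : #S = 3) (hu : u ∈ S) (hv : v ∈ S)
    (huv : u ≠ v) : G.Adj u v := by
  by_contra hadj
  have h1 := degIn_erase_add (G := G) (u := u) hv
  have h2 := hS.2 u hu
  have h4 : u ∈ S.erase v := mem_erase.2 ⟨huv, hu⟩
  have h5 := degIn_lt_card (G := G) h4
  rw [card_erase_of_mem hv] at h5
  simp only [hadj, if_false] at h1
  omega

/-- A vertex with three neighbours in a minimal core of size at least four yields a smaller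
core. -/
theorem IsCore.exists_card_lt (hS : G.IsCore S) (hmin : ∀ T ⊂ S, ¬ G.IsCore T) (hv : v ∉ S)
    (hdeg : 3 ≤ G.degIn S v) (hcard : 4 ≤ #S) :
    ∃ T ⊆ insert v S, G.IsCore T ∧ #T < #S := by
  have hreg := hS.degIn_eq_two hmin
  obtain ⟨x, hx⟩ : ({w ∈ S | G.Adj v w}).Nonempty := card_pos.1 (by unfold degIn at hdeg; omega)
  obtain ⟨hxS, hvx⟩ := mem_filter.1 hx
  obtain ⟨y, hy⟩ : ({w ∈ S | G.Adj x w}).Nonempty :=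
    card_pos.1 (by have := hreg x hxS; unfold degIn at this; omega)
  obtain ⟨hyS, hxy⟩ := mem_filter.1 hy
  by_cases hvy : G.Adj v y
  · refine ⟨{v, x, y}, ?_, isCore_triple hvx hvy hxy, card_le_three.trans_lt (by omega)⟩
    intro t ht
    simp only [mem_insert, mem_singleton] at ht ⊢
    rcases ht with rfl | rfl | rfl <;> simp [*]
  -- Adding `v` and removing the adjacent `x`, `y` changes the degree sum by at least `6 - 6 - 2`
  -- and the size by `-1`, so as many edges as vertices remain.
  have hyx : y ∈ (insert v S).erase x := by simp [hxy.ne', hyS]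
  have hxv : x ∈ insert v S := mem_insert_of_mem hxS
  have e1 := degSum_insert (G := G) hv
  have e2 := degSum_erase_add (G := G) hxv
  have e3 := degSum_erase_add (G := G) hyx
  have d1 := degIn_insert (G := G) (u := x) hv
  have d2 := degIn_insert (G := G) (u := y) hv
  have d3 := degIn_erase_add (G := G) (u := y) hxv
  simp only [hvx.symm, if_true] at d1
  simp only [G.adj_comm y v, hvy, if_false] at d2
  simp only [hxy.symm, if_true] at d3
  have hx2 := hreg x hxS
  have hy2 := hreg y hyS
  have hsum : G.degSum S = 2 * #S := by
    rw [degSum, sum_congr rfl hreg, sum_const, smul_eq_mul, mul_comm]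
  have c1 := card_insert_of_notMem hv
  have c2 := card_erase_add_one hxv
  have c3 := card_erase_add_one hyx
  obtain ⟨T, hT, hc⟩ := exists_isCore_of_le_degSum (G := G) (((insert v S).erase x).erase y)
    (card_pos.1 (by omega)) (by omega)
  refine ⟨T, hT.trans ((erase_subset _ _).trans (erase_subset _ _)), hc, ?_⟩
  have := card_le_card hT
  omega

end Core

end SimpleGraph

/-! ### Optimal packings and exchanges. -/

namespace SimpleGraph

section Packing

open Finset
open scoped Classical

variable {V ι : Type*}

theorem eq_or_eq_of_card_eq_three {S : Finset V} {x y z : V} (h3 : #S = 3) (hx : x ∈ S) (hy : y ∈ S)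
    (hz : z ∈ S) (hxy : x ≠ y) (hxz : x ≠ z) (hyz : y ≠ z) {t : V} (ht : t ∈ S) (htx : t ≠ x) :
    t = y ∨ t = z := by
  have hS : ({x, y, z} : Finset V) = S := by
    refine eq_of_subset_of_card_le ?_ (by rw [h3, card_eq_three.2 ⟨x, y, z, hxy, hxz, hyz, rfl⟩])
    intro w hw
    simp only [mem_insert, mem_singleton] at hw
    rcases hw with rfl | rfl | rfl <;> assumption
  rw [← hS] at ht
  simpa [htx] using ht

/-- The family obtained from `W` by replacing `x` by `v` in its `i`-th member. -/
noncomputable def swap (W : ι → Finset V) (i : ι) (x v : V) : ι → Finset V :=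
  Function.update W i (insert v ((W i).erase x))

theorem swap_of_ne {W : ι → Finset V} {i j : ι} {x v : V} (h : j ≠ i) : swap W i x v j = W j := Function.update_of_ne h _ _

variable [Fintype V] [Fintype ι] (G : SimpleGraph V)

/-- A family of pairwise disjoint cores. -/
structure IsPacking (W : ι → Finset V) : Prop where
  disjoint : Pairwise fun i j => Disjoint (W i) (W j)
  isCore : ∀ i, G.IsCore (W i)

/-- The set of vertices covered by no member of the family. -/
noncomputable def rest (W : ι → Finset V) : Finset V := (univ.biUnion W)ᶜ

/-- A packing covering as few vertices as possible, and subject to that, leaving as many edges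
uncovered as possible. -/
structure IsOptimal (W : ι → Finset V) : Prop extends G.IsPacking W where
  card_le : ∀ W' : ι → Finset V, G.IsPacking W' → #(rest W') ≤ #(rest W)
  degSum_le : ∀ W' : ι → Finset V, G.IsPacking W' → #(rest W') = #(rest W) →
    G.degSum (rest W') ≤ G.degSum (rest W)

variable {G} {W : ι → Finset V} {C : Finset V} {i : ι} {u v x y z a b p q : V}

theorem mem_rest : v ∈ rest W ↔ ∀ i, v ∉ W i := by simp [rest]

theorem notMem_of_mem_rest (hv : v ∈ rest W) : v ∉ W i := mem_rest.1 hv i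

theorem ne_of_mem_rest (hv : v ∈ rest W) (hx : x ∈ W i) : v ≠ x := by
  rintro rfl
  exact notMem_of_mem_rest hv hx

theorem IsPacking.exists_isOptimal (hW : G.IsPacking W) :
    ∃ W' : ι → Finset V, G.IsOptimal W' ∧ #(rest W) ≤ #(rest W') := by
  obtain ⟨W', hW', hmax⟩ := Finset.exists_max_image {W' : ι → Finset V | G.IsPacking W'}
    (fun W' => toLex (#(rest W'), G.degSum (rest W'))) ⟨W, by simpa using hW⟩
  simp only [mem_filter, mem_univ, true_and] at hW' hmax
  have h (W'' : ι → Finset V) (h'' : G.IsPacking W'') := Prod.Lex.toLex_le_toLex.1 (hmax W'' h'')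
  have hcard (W'' : ι → Finset V) (h'' : G.IsPacking W'') : #(rest W'') ≤ #(rest W') := by
    rcases h W'' h'' with h1 | ⟨h1, -⟩
    exacts [h1.le, h1.le]
  refine ⟨W', ⟨hW', hcard, fun W'' h'' he => ?_⟩, hcard W hW⟩
  rcases h W'' h'' with h1 | ⟨-, h2⟩
  · exact absurd h1 (he ▸ lt_irrefl _)
  · exact h2

theorem degIn_univ (hW : G.IsPacking W) :
    G.degIn univ v = G.degIn (rest W) v + ∑ i, G.degIn (W i) v := by
  have h : (univ : Finset V) = rest W ∪ univ.biUnion W := by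
    simp [rest, union_comm]
  rw [h, degIn_union (by simpa [rest] using disjoint_compl_left)]
  congr 1
  simp only [degIn, card_filter]
  rw [sum_biUnion fun i _ j _ hij => hW.disjoint hij]

theorem IsPacking.update (hW : G.IsPacking W) (hC : G.IsCore C) (hCW : C ⊆ rest W ∪ W i) :
    G.IsPacking (Function.update W i C) := by
  have hdis : ∀ j, j ≠ i → Disjoint C (W j) := by
    intro j hj
    rw [Finset.disjoint_left]
    intro v hv hvj
    rcases mem_union.1 (hCW hv) with h | h
    · exact notMem_of_mem_rest h hvj
    · exact Finset.disjoint_left.1 (hW.disjoint hj) hvj h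
  refine ⟨fun j l hjl => ?_, fun j => ?_⟩
  · by_cases hj : j = i
    · subst hj
      rw [Function.update_self, Function.update_of_ne hjl.symm]
      exact hdis l hjl.symm
    · beta_reduce
      rw [Function.update_of_ne hj]
      by_cases hl : l = i
      · subst hl
        rw [Function.update_self]
        exact (hdis j hj).symm
      · rw [Function.update_of_ne hl]
        exact hW.disjoint hjl
  · by_cases hj : j = i
    · subst hj
      rwa [Function.update_self]
    · rw [Function.update_of_ne hj]
      exact hW.isCore j

theorem rest_update (hW : G.IsPacking W) :
    rest (Function.update W i C) = (rest W ∪ W i) \ C := by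
  ext v
  simp only [mem_rest, mem_sdiff, mem_union]
  constructor
  · intro h
    refine ⟨?_, by simpa using h i⟩
    by_cases hv : v ∈ W i
    · exact Or.inr hv
    · refine Or.inl fun j => ?_
      by_cases hj : j = i
      · rwa [hj]
      · simpa [Function.update_of_ne hj] using h j
  · rintro ⟨h, hC⟩ j
    by_cases hj : j = i
    · subst hj
      simpa using hC
    · rw [Function.update_of_ne hj]
      rcases h with h | h
      · exact h j
      · exact fun hvj => Finset.disjoint_left.1 (hW.disjoint hj) hvj h

theorem IsOptimal.card_le_of_isCore (hW : G.IsOptimal W) (hC : G.IsCore C)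
    (hCW : C ⊆ rest W ∪ W i) : #(W i) ≤ #C := by
  have h1 := hW.card_le _ (hW.toIsPacking.update hC hCW)
  have hdis : Disjoint (rest W) (W i) :=
    Finset.disjoint_left.2 fun v hv hvi => notMem_of_mem_rest hv hvi
  rw [rest_update hW.toIsPacking, card_sdiff_of_subset hCW, card_union_of_disjoint hdis] at h1
  have h2 := card_le_card hCW
  rw [card_union_of_disjoint hdis] at h2
  omega

/-- A larger member is a minimal core, and `v` would yield a smaller one to replace it, enlarging
the rest. -/
theorem IsOptimal.card_eq_three_of_le_degIn (hW : G.IsOptimal W) (hv : v ∈ rest W)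
    (h : 3 ≤ G.degIn (W i) v) : #(W i) = 3 := by
  refine le_antisymm ?_ (hW.isCore i).three_le_card
  by_contra hcard
  have hmin : ∀ T ⊂ W i, ¬ G.IsCore T := fun T hT hc =>
    (hW.card_le_of_isCore hc (hT.subset.trans subset_union_right)).not_gt (card_lt_card hT)
  obtain ⟨T, hT, hc, hlt⟩ :=
    (hW.isCore i).exists_card_lt hmin (notMem_of_mem_rest hv) h (by omega)
  refine (hW.card_le_of_isCore hc (hT.trans (insert_subset ?_ subset_union_right))).not_gt hlt
  exact mem_union_left _ hv

theorem rest_swap (hW : G.IsPacking W) (hv : v ∈ rest W) (hx : x ∈ W i) :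
    rest (swap W i x v) = insert x ((rest W).erase v) := by
  rw [swap, rest_update hW]
  ext w
  simp only [mem_sdiff, mem_union, mem_insert, mem_erase]
  have h1 : w ∈ rest W → w ∉ W i := fun h => notMem_of_mem_rest h
  have h2 := ne_of_mem_rest hv hx
  by_cases hwx : w = x
  · subst hwx
    simp [hx, h2.symm]
  · by_cases hwv : w = v
    · subst hwv
      simp [hwx]
    · simp only [hwx, hwv]
      tauto

theorem IsOptimal.isPacking_swap (hW : G.IsOptimal W) (hv : v ∈ rest W) (h3 : #(W i) = 3)
    (hx : x ∈ W i) (hadj : ∀ y ∈ W i, y ≠ x → G.Adj v y) : G.IsPacking (swap W i x v) := by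
  refine hW.toIsPacking.update ?_ ?_
  · obtain ⟨y, z, hyz, he⟩ : ∃ y z, y ≠ z ∧ (W i).erase x = {y, z} :=
      card_eq_two.1 (by rw [card_erase_of_mem hx]; omega)
    have hy : y ∈ (W i).erase x := by simp [he]
    have hz : z ∈ (W i).erase x := by simp [he]
    rw [mem_erase] at hy hz
    rw [he]
    exact isCore_triple (hadj y hy.2 hy.1) (hadj z hz.2 hz.1)
      ((hW.isCore i).adj_of_card_eq_three h3 hy.2 hz.2 hyz)
  · exact insert_subset (mem_union_left _ hv) ((erase_subset _ _).trans subset_union_right)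

theorem IsPacking.card_rest_swap (hW : G.IsPacking W) (hv : v ∈ rest W) (hx : x ∈ W i) :
    #(rest (swap W i x v)) = #(rest W) := by
  rw [rest_swap hW hv hx, card_insert_of_notMem, card_erase_add_one hv]
  exact fun h => notMem_of_mem_rest (mem_of_mem_erase h) hx

theorem IsPacking.degSum_rest_swap (hW : G.IsPacking W) (hv : v ∈ rest W) (hx : x ∈ W i) :
    G.degSum (rest (swap W i x v)) + 2 * G.degIn (rest W) v
      = G.degSum (rest W) + 2 * G.degIn ((rest W).erase v) x := by
  have h1 : x ∉ (rest W).erase v := fun h => notMem_of_mem_rest (mem_of_mem_erase h) hx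
  have h2 := degSum_erase_add (G := G) hv
  rw [rest_swap hW hv hx, degSum_insert h1]
  omega

/-- Exchanging `v` with `x` keeps the number of uncovered vertices, so by the second optimality
condition the rest cannot gain edges. -/
theorem IsOptimal.degIn_erase_le (hW : G.IsOptimal W) (hv : v ∈ rest W) (h3 : #(W i) = 3)
    (hx : x ∈ W i) (hadj : ∀ y ∈ W i, y ≠ x → G.Adj v y) :
    G.degIn ((rest W).erase v) x ≤ G.degIn (rest W) v := by
  have h1 := hW.degSum_le _ (hW.isPacking_swap hv h3 hx hadj)
    (hW.toIsPacking.card_rest_swap hv hx)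
  have h2 := hW.toIsPacking.degSum_rest_swap hv hx
  omega

theorem IsOptimal.isOptimal_swap (hW : G.IsOptimal W) (hv : v ∈ rest W) (h3 : #(W i) = 3)
    (hx : x ∈ W i) (hadj : ∀ y ∈ W i, y ≠ x → G.Adj v y)
    (heq : G.degIn ((rest W).erase v) x = G.degIn (rest W) v) :
    G.IsOptimal (swap W i x v) := by
  have h1 := hW.toIsPacking.card_rest_swap hv hx
  have h2 := hW.toIsPacking.degSum_rest_swap hv hx
  refine ⟨hW.isPacking_swap hv h3 hx hadj, fun W' h => h1 ▸ hW.card_le W' h, fun W' h hc => ?_⟩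
  have h4 := hW.degSum_le W' h (hc.trans h1)
  omega

theorem IsOptimal.card_le_degIn_rest (hW : G.IsOptimal W) (hv : v ∈ rest W) (h3 : #(W i) = 3)
    (hx : x ∈ W i) (hy : y ∈ W i) (hz : z ∈ W i) (hxy : x ≠ y) (hxz : x ≠ z) (hyz : y ≠ z)
    (hvy : G.Adj v y) (hvz : G.Adj v z) {T : Finset V} (hT : T ⊆ (rest W).erase v)
    (hTx : ∀ t ∈ T, G.Adj t x) : #T ≤ G.degIn (rest W) v := by
  refine (card_le_degIn hT fun t ht => (hTx t ht).symm).trans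
    (hW.degIn_erase_le hv h3 hx fun t ht htx => ?_)
  rcases eq_or_eq_of_card_eq_three h3 hx hy hz hxy hxz hyz ht htx with rfl | rfl <;> assumption

theorem IsOptimal.not_adj_of_degIn_le_one (hW : G.IsOptimal W) (ha : a ∈ rest W)
    (hb : b ∈ rest W) (hp : p ∈ rest W) (hab : a ≠ b) (hap : a ≠ p) (hbp : b ≠ p)
    (hda : G.degIn (rest W) a ≤ 1) (h3 : #(W i) = 3)
    (hx : x ∈ W i) (hy : y ∈ W i) (hz : z ∈ W i) (hxy : x ≠ y) (hxz : x ≠ z) (hyz : y ≠ z)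
    (hay : G.Adj a y) (haz : G.Adj a z) (hbx : G.Adj b x) : ¬ G.Adj p x := by
  intro hpx
  have := hW.card_le_degIn_rest ha h3 hx hy hz hxy hxz hyz hay haz (T := {b, p})
    (by simp [insert_subset_iff, hb, hp, hab.symm, hap.symm]) (by simp [hbx, hpx])
  rw [card_pair hbp] at this
  omega

theorem IsOptimal.blocked_of_degIn_le_one (hW : G.IsOptimal W) (ha : a ∈ rest W)
    (hb : b ∈ rest W) (hp : p ∈ rest W) (hab : a ≠ b) (hap : a ≠ p) (hbp : b ≠ p)
    (hda : G.degIn (rest W) a ≤ 1) (h3 : #(W i) = 3)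
    (hx : x ∈ W i) (hy : y ∈ W i) (hz : z ∈ W i) (hxy : x ≠ y) (hxz : x ≠ z) (hyz : y ≠ z) :
    blocked (decide (G.Adj a x)) (decide (G.Adj a y)) (decide (G.Adj a z)) (decide (G.Adj b x))
      (decide (G.Adj b y)) (decide (G.Adj b z)) (decide (G.Adj p x)) (decide (G.Adj p y))
      (decide (G.Adj p z)) = true := by
  have h1 := hW.not_adj_of_degIn_le_one ha hb hp hab hap hbp hda h3 hx hy hz hxy hxz hyz
  have h2 := hW.not_adj_of_degIn_le_one ha hb hp hab hap hbp hda h3 hy hx hz hxy.symm hyz hxz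
  have h4 := hW.not_adj_of_degIn_le_one ha hb hp hab hap hbp hda h3 hz hx hy hxz.symm hyz.symm hxy
  simp only [blocked, Bool.and_eq_true, Bool.not_eq_true', ← Bool.not_eq_true, decide_eq_true_eq]
  exact ⟨⟨fun h => h1 h.1.1.1 h.1.1.2 h.1.2 h.2, fun h => h2 h.1.1.1 h.1.1.2 h.1.2 h.2⟩,
    fun h => h4 h.1.1.1 h.1.1.2 h.1.2 h.2⟩

theorem IsOptimal.blocked_of_degIn_le_two (hW : G.IsOptimal W) (ha : a ∈ rest W)
    (hb : b ∈ rest W) (hp : p ∈ rest W) (hq : q ∈ rest W) (hab : a ≠ b) (hap : a ≠ p)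
    (haq : a ≠ q) (hbp : b ≠ p) (hbq : b ≠ q) (hpq : p ≠ q)
    (hda : G.degIn (rest W) a ≤ 2) (h3 : #(W i) = 3)
    (hx : x ∈ W i) (hy : y ∈ W i) (hz : z ∈ W i) (hxy : x ≠ y) (hxz : x ≠ z) (hyz : y ≠ z) :
    blocked (decide (G.Adj a x)) (decide (G.Adj a y)) (decide (G.Adj a z))
      (decide (G.Adj b x) && decide (G.Adj p x)) (decide (G.Adj b y) && decide (G.Adj p y))
      (decide (G.Adj b z) && decide (G.Adj p z)) (decide (G.Adj q x)) (decide (G.Adj q y))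
      (decide (G.Adj q z)) = true := by
  have key : ∀ {x y z : V}, x ∈ W i → y ∈ W i → z ∈ W i → x ≠ y → x ≠ z → y ≠ z → G.Adj a y →
      G.Adj a z → G.Adj b x → G.Adj p x → ¬ G.Adj q x := by
    intro x y z hx hy hz hxy hxz hyz hay haz hbx hpx hqx
    have := hW.card_le_degIn_rest ha h3 hx hy hz hxy hxz hyz hay haz (T := {b, p, q})
      (by simp [insert_subset_iff, hb, hp, hq, hab.symm, hap.symm, haq.symm])
      (by simp [hbx, hpx, hqx])
    rw [card_eq_three.2 ⟨b, p, q, hbp, hbq, hpq, rfl⟩] at this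
    omega
  have h1 := key hx hy hz hxy hxz hyz
  have h2 := key hy hx hz hxy.symm hyz hxz
  have h3 := key hz hx hy hxz.symm hyz.symm hxy
  simp only [blocked, Bool.and_eq_true, Bool.not_eq_true', ← Bool.not_eq_true, decide_eq_true_eq]
  exact ⟨⟨fun h => h1 h.1.1.1 h.1.1.2 h.1.2.1 h.1.2.2 h.2,
    fun h => h2 h.1.1.1 h.1.1.2 h.1.2.1 h.1.2.2 h.2⟩,
    fun h => h3 h.1.1.1 h.1.1.2 h.1.2.1 h.1.2.2 h.2⟩

/-- Either some member is a triangle, or it receives at most two edges from each vertex outside. -/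
theorem IsOptimal.card_eq_three_or (hW : G.IsOptimal W) (i : ι) :
    (∃ x y z, x ∈ W i ∧ y ∈ W i ∧ z ∈ W i ∧ x ≠ y ∧ x ≠ z ∧ y ≠ z ∧ #(W i) = 3 ∧
      ∀ v, G.degIn (W i) v = (decide (G.Adj v x)).toNat + (decide (G.Adj v y)).toNat
        + (decide (G.Adj v z)).toNat) ∨
    (#(W i) ≠ 3 ∧ ∀ v ∈ rest W, G.degIn (W i) v ≤ 2) := by
  by_cases h3 : #(W i) = 3
  · obtain ⟨x, y, z, hxy, hxz, hyz, he⟩ := card_eq_three.1 h3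
    refine Or.inl ⟨x, y, z, by simp [he], by simp [he], by simp [he], hxy, hxz, hyz, h3, ?_⟩
    intro v
    rw [he]
    exact degIn_triple hxy hxz hyz
  · refine Or.inr ⟨h3, fun v hv => ?_⟩
    by_contra h
    exact h3 (hW.card_eq_three_of_le_degIn hv (by omega))

end Packing

end SimpleGraph

/-! ### Structure of the rest of an optimal packing. -/

namespace SimpleGraph

section CorradiHajnal

open Finset
open scoped Classical

variable {V ι : Type*} [Fintype V] [Fintype ι] {G : SimpleGraph V}
  {W : ι → Finset V} {t : ι} {x y z a b d p q : V}

/-- Three such vertices would have total degree at most `3 + 6 * Fintype.card ι`, three short of the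
required sum. -/
theorem IsOptimal.not_three_degIn_le_one (hW : G.IsOptimal W)
    (hdeg : ∀ v, 2 * (Fintype.card ι + 1) ≤ G.degIn univ v)
    (ha : a ∈ rest W) (hb : b ∈ rest W) (hd : d ∈ rest W) (hab : a ≠ b) (had : a ≠ d)
    (hbd : b ≠ d) (ha1 : G.degIn (rest W) a ≤ 1) (hb1 : G.degIn (rest W) b ≤ 1) :
    2 ≤ G.degIn (rest W) d := by
  by_contra hd1
  have key : ∀ i ∈ univ, G.degIn (W i) a + G.degIn (W i) b + G.degIn (W i) d ≤ 6 := by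
    intro i _
    rcases hW.card_eq_three_or i with ⟨x, y, z, hx, hy, hz, hxy, hxz, hyz, h3, hsum⟩ | ⟨-, h⟩
    · rw [hsum, hsum, hsum]
      exact sum_le_six_of_blocked _ _ _ _ _ _ _ _ _
        (hW.blocked_of_degIn_le_one ha hb hd hab had hbd ha1 h3 hx hy hz hxy hxz hyz)
        (hW.blocked_of_degIn_le_one hb ha hd hab.symm hbd had hb1 h3 hx hy hz hxy hxz hyz)
        (hW.blocked_of_degIn_le_one hd ha hb had.symm hbd.symm hab (by omega) h3
          hx hy hz hxy hxz hyz)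
    · have := h a ha
      have := h b hb
      have := h d hd
      omega
  have hs := sum_le_card_nsmul _ _ _ key
  rw [sum_add_distrib, sum_add_distrib, smul_eq_mul, card_univ] at hs
  have h1 := hdeg a
  have h2 := hdeg b
  have h3 := hdeg d
  rw [degIn_univ hW.toIsPacking] at h1 h2 h3
  omega

theorem IsOptimal.one_le_degIn (hW : G.IsOptimal W)
    (hdeg : ∀ v, 2 * (Fintype.card ι + 1) ≤ G.degIn univ v) (hcard : 3 ≤ #(rest W))
    (hno : ∀ T ⊆ rest W, ¬ G.IsCore T) (ha : a ∈ rest W) : 1 ≤ G.degIn (rest W) a := by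
  by_contra ha0
  have ha0 : G.degIn (rest W) a = 0 := by omega
  set S := (rest W).erase a
  have hSR : S ⊆ rest W := erase_subset _ _
  have hSc : #S + 1 = #(rest W) := card_erase_add_one ha
  have hSne : S.Nonempty := card_pos.1 (by omega)
  have hSdeg : ∀ v ∈ S, G.degIn S v = G.degIn (rest W) v :=
    fun v hv => degIn_erase_of_degIn_eq_zero ha0 (hSR hv)
  have hSsum := degSum_add_two_le_of_forall_not_isCore hSne fun T hT => hno T (hT.trans hSR)
  obtain ⟨b, hb, hb2⟩ : ∃ b ∈ S, G.degIn S b < 2 := by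
    by_contra! h
    exact hno S hSR ⟨hSne, h⟩
  have hba := (mem_erase.1 hb).1
  have hS2 : ∀ v ∈ S.erase b, 2 ≤ G.degIn S v := by
    intro v hv
    have hvS := mem_of_mem_erase hv
    rw [hSdeg v hvS]
    refine hW.not_three_degIn_le_one hdeg ha (hSR hb) (hSR hvS) hba.symm
      (mem_erase.1 hvS).1.symm (mem_erase.1 hv).1.symm (by omega) ?_
    rw [← hSdeg b hb]
    omega
  -- The forest bound on `S` now forces `b` to be isolated in `S`, so erasing it costs no degree and
  -- leaves a core.
  have h1 : #(S.erase b) * 2 ≤ ∑ v ∈ S.erase b, G.degIn S v := card_nsmul_le_sum _ _ 2 hS2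
  have h2 : ∑ v ∈ S.erase b, G.degIn S v + G.degIn S b = G.degSum S := sum_erase_add _ _ hb
  have h3 := card_erase_add_one hb
  refine hno (S.erase b) ((erase_subset _ _).trans hSR) ⟨card_pos.1 (by omega), fun v hv => ?_⟩
  rw [degIn_erase_of_degIn_eq_zero (by omega) (mem_of_mem_erase hv)]
  exact hS2 v hv

/-- The uncovered vertices induce a graph with the degrees of a path. -/
theorem IsOptimal.exists_degIn_eq (hW : G.IsOptimal W)
    (hdeg : ∀ v, 2 * (Fintype.card ι + 1) ≤ G.degIn univ v) (hcard : 3 ≤ #(rest W))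
    (hno : ∀ T ⊆ rest W, ¬ G.IsCore T) :
    ∃ a ∈ rest W, ∃ b ∈ rest W, a ≠ b ∧ G.degIn (rest W) a = 1 ∧ G.degIn (rest W) b = 1 ∧
      ∀ v ∈ rest W, v ≠ a → v ≠ b → G.degIn (rest W) v = 2 := by
  have hpos (v : V) (hv : v ∈ rest W) := hW.one_le_degIn hdeg hcard hno hv
  have hne : (rest W).Nonempty := card_pos.1 (by omega)
  have hsum := degSum_add_two_le_of_forall_not_isCore hne hno
  obtain ⟨a, ha, ha2⟩ : ∃ a ∈ rest W, G.degIn (rest W) a < 2 := by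
    by_contra! h
    exact hno _ subset_rfl ⟨hne, h⟩
  have ha1 := hpos a ha
  have h1 : ∑ v ∈ (rest W).erase a, G.degIn (rest W) v + G.degIn (rest W) a
    = G.degSum (rest W) := sum_erase_add _ _ ha
  have h2 := card_erase_add_one ha
  obtain ⟨b, hb, hb2⟩ : ∃ b ∈ (rest W).erase a, G.degIn (rest W) b < 2 := by
    by_contra! h
    have : #((rest W).erase a) * 2 ≤ ∑ v ∈ (rest W).erase a, G.degIn (rest W) v :=
      card_nsmul_le_sum _ _ 2 h
    omega
  obtain ⟨hba, hbR⟩ := mem_erase.1 hb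
  have hb1 := hpos b hbR
  have h3 := sum_erase_add _ (G.degIn (rest W)) hb
  have h4 := card_erase_add_one hb
  have hge : ∀ v ∈ ((rest W).erase a).erase b, 2 ≤ G.degIn (rest W) v := by
    intro v hv
    simp only [mem_erase] at hv
    exact hW.not_three_degIn_le_one hdeg ha hbR hv.2.2 hba.symm hv.2.1.symm hv.1.symm
      (by omega) (by omega)
  have heq := le_antisymm (sum_le_sum hge) (by rw [sum_const, smul_eq_mul]; omega)
  refine ⟨a, ha, b, hbR, hba.symm, by omega, by omega, fun v hv hva hvb => ?_⟩
  exact ((sum_eq_sum_iff_of_le hge).1 heq v (by simp [hv, hva, hvb])).symm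

/-- Both ends and two further vertices receive `1 + 1 + 2 + 2 = 6` inside the rest and at most eight
per member, two short of four times the minimum degree. -/
theorem IsOptimal.card_rest_le_three (hW : G.IsOptimal W)
    (hdeg : ∀ v, 2 * (Fintype.card ι + 1) ≤ G.degIn univ v)
    (ha : a ∈ rest W) (hb : b ∈ rest W) (hab : a ≠ b) (ha1 : G.degIn (rest W) a = 1)
    (hb1 : G.degIn (rest W) b = 1)
    (h2 : ∀ v ∈ rest W, v ≠ a → v ≠ b → G.degIn (rest W) v = 2) : #(rest W) ≤ 3 := by
  by_contra hcard
  have hb' : b ∈ (rest W).erase a := mem_erase.2 ⟨hab.symm, hb⟩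
  have c1 := card_erase_add_one ha
  have c2 := card_erase_add_one hb'
  obtain ⟨p, hp, q, hq, hpq⟩ := one_lt_card.1 (show 1 < #(((rest W).erase a).erase b) by omega)
  simp only [mem_erase] at hp hq
  obtain ⟨hpb, hpa, hp⟩ := hp
  obtain ⟨hqb, hqa, hq⟩ := hq
  have hp2 := h2 p hp hpa hpb
  have hq2 := h2 q hq hqa hqb
  have key : ∀ i ∈ univ, G.degIn (W i) a + G.degIn (W i) b + G.degIn (W i) p
      + G.degIn (W i) q ≤ 8 := by
    intro i _
    rcases hW.card_eq_three_or i with ⟨x, y, z, hx, hy, hz, hxy, hxz, hyz, h3, hsum⟩ | ⟨-, h⟩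
    · rw [hsum, hsum, hsum, hsum]
      exact sum_le_eight_of_blocked _ _ _ _ _ _ _ _ _
        (hW.blocked_of_degIn_le_one ha hb hp hab hpa.symm hpb.symm ha1.le h3
          hx hy hz hxy hxz hyz)
        (hW.blocked_of_degIn_le_one hb ha hp hab.symm hpb.symm hpa.symm hb1.le h3
          hx hy hz hxy hxz hyz) _ _ _
        (hW.blocked_of_degIn_le_one ha hb hq hab hqa.symm hqb.symm ha1.le h3
          hx hy hz hxy hxz hyz)
        (hW.blocked_of_degIn_le_one hb ha hq hab.symm hqb.symm hqa.symm hb1.le h3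
          hx hy hz hxy hxz hyz)
        (hW.blocked_of_degIn_le_one ha hp hq hpa.symm hqa.symm hpq ha1.le h3
          hx hy hz hxy hxz hyz)
        (hW.blocked_of_degIn_le_one hb hp hq hpb.symm hqb.symm hpq hb1.le h3
          hx hy hz hxy hxz hyz)
        (hW.blocked_of_degIn_le_two hp ha hb hq hpa hpb hpq hab hqa.symm hqb.symm hp2.le h3
          hx hy hz hxy hxz hyz)
        (hW.blocked_of_degIn_le_two hq ha hb hp hqa hqb hpq.symm hab hpa.symm hpb.symm hq2.le h3
          hx hy hz hxy hxz hyz)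
    · have := h a ha
      have := h b hb
      have := h p hp
      have := h q hq
      omega
  have hs := sum_le_card_nsmul _ _ _ key
  rw [sum_add_distrib, sum_add_distrib, sum_add_distrib, smul_eq_mul, card_univ] at hs
  have h1 := hdeg a
  have h2 := hdeg b
  have h3 := hdeg p
  have h4 := hdeg q
  rw [degIn_univ hW.toIsPacking] at h1 h2 h3 h4
  omega

/-- Exchanging `a` with `x`, or `b` with `z`, gives two further optimal packings. Weighing `p`
twice, the degrees of `a`, `b`, `x`, `z`, `p` total at most 10 in the rest, 10 in `W t` and 12 in
every other member, below six times the minimum degree. -/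
theorem IsOptimal.false_of_adj (hW : G.IsOptimal W)
    (hdeg : ∀ v, 2 * (Fintype.card ι + 1) ≤ G.degIn univ v) (hR : rest W = {a, b, p})
    (hab : a ≠ b) (hap : G.Adj a p) (hbp : G.Adj b p) (hnab : ¬ G.Adj a b)
    (h3 : #(W t) = 3) (hx : x ∈ W t) (hy : y ∈ W t) (hz : z ∈ W t) (hxy : x ≠ y) (hxz : x ≠ z)
    (hyz : y ≠ z) (hax : G.Adj a x) (hay : G.Adj a y) (haz : G.Adj a z) (hbx : G.Adj b x)
    (hby : G.Adj b y) : False := by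
  have ha : a ∈ rest W := by simp [hR]
  have hb : b ∈ rest W := by simp [hR]
  have hp : p ∈ rest W := by simp [hR]
  have hdR (v : V) := degIn_triple (G := G) (v := v) hab hap.ne hbp.ne
  rw [← hR] at hdR
  have da : G.degIn (rest W) a = 1 := by simp [hdR, hnab, hap]
  have db : G.degIn (rest W) b = 1 := by simp [hdR, G.adj_comm b a, hnab, hbp]
  have dp : G.degIn (rest W) p = 2 := by simp [hdR, hap.symm, hbp.symm]
  have hpx : ¬ G.Adj p x := hW.not_adj_of_degIn_le_one ha hb hp hab hap.ne hbp.ne da.le h3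
    hx hy hz hxy hxz hyz hay haz hbx
  have hpy : ¬ G.Adj p y := hW.not_adj_of_degIn_le_one ha hb hp hab hap.ne hbp.ne da.le h3
    hy hx hz hxy.symm hyz hxz hax haz hby
  have hpz : ¬ G.Adj p z := hW.not_adj_of_degIn_le_one hb ha hp hab.symm hbp.ne hap.ne db.le h3
    hz hx hy hxz.symm hyz.symm hxy hbx hby haz
  have dx : G.degIn (rest W) x = 2 := by simp [hdR, hax.symm, hbx.symm, G.adj_comm x p, hpx]
  have dz : G.degIn (rest W) z = 1 + (if G.Adj z b then 1 else 0) := by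
    by_cases h : G.Adj z b <;> simp [hdR, haz.symm, G.adj_comm z p, hpz, h]
  have hxa := ne_of_mem_rest ha hx
  have hxb := ne_of_mem_rest hb hx
  have hxp := ne_of_mem_rest hp hx
  have hza := ne_of_mem_rest ha hz
  have hzb := ne_of_mem_rest hb hz
  have hzp := ne_of_mem_rest hp hz
  -- exchanging `a` and `x`
  have hW₁ : G.IsOptimal (swap W t x a) := by
    refine hW.isOptimal_swap ha h3 hx (fun u hu hux => ?_) ?_
    · rcases eq_or_eq_of_card_eq_three h3 hx hy hz hxy hxz hyz hu hux with rfl | rfl <;> assumption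
    · have := degIn_erase_add (G := G) (u := x) ha
      rw [if_pos hax.symm] at this
      omega
  have hR₁ : rest (swap W t x a) = {x, b, p} := by
    rw [rest_swap hW.toIsPacking ha hx, hR, erase_insert (by simp [hab, hap.ne])]
  have hd₁ (v : V) := degIn_triple (G := G) (v := v) hxb.symm hxp.symm hbp.ne
  rw [← hR₁] at hd₁
  have dx₁ : G.degIn (rest (swap W t x a)) x = 1 := by
    simp [hd₁, hbx.symm, G.adj_comm x p, hpx]
  have dp₁ : G.degIn (rest (swap W t x a)) p = 1 := by simp [hd₁, hbp.symm, hpx]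
  have hx₁ : x ∈ rest (swap W t x a) := by simp [hR₁]
  have hb₁ : b ∈ rest (swap W t x a) := by simp [hR₁]
  have hp₁ : p ∈ rest (swap W t x a) := by simp [hR₁]
  -- exchanging `b` and `z`
  have hW₂ : G.IsOptimal (swap W t z b) := by
    refine hW.isOptimal_swap hb h3 hz (fun u hu huz => ?_) ?_
    · rcases eq_or_eq_of_card_eq_three h3 hz hx hy hxz.symm hyz.symm hxy hu huz with
        rfl | rfl <;> assumption
    · have := degIn_erase_add (G := G) (u := z) hb
      omega
  have hR₂ : rest (swap W t z b) = {z, a, p} := by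
    rw [rest_swap hW.toIsPacking hb hz, hR, insert_comm a b,
      erase_insert (by simp [hab.symm, hbp.ne])]
  have hd₂ (v : V) := degIn_triple (G := G) (v := v) hza.symm hzp.symm hap.ne
  rw [← hR₂] at hd₂
  have dz₂ : G.degIn (rest (swap W t z b)) z = 1 := by
    simp [hd₂, haz.symm, G.adj_comm z p, hpz]
  have dp₂ : G.degIn (rest (swap W t z b)) p = 1 := by simp [hd₂, hap.symm, hpz]
  have hz₂ : z ∈ rest (swap W t z b) := by simp [hR₂]
  have ha₂ : a ∈ rest (swap W t z b) := by simp [hR₂]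
  have hp₂ : p ∈ rest (swap W t z b) := by simp [hR₂]
  have key : ∀ i ∈ univ.erase t, G.degIn (W i) a + G.degIn (W i) b + G.degIn (W i) x
      + G.degIn (W i) z + 2 * G.degIn (W i) p ≤ 12 := by
    intro i hi
    have hit := (mem_erase.1 hi).1
    have e₁ : swap W t x a i = W i := swap_of_ne hit
    have e₂ : swap W t z b i = W i := swap_of_ne hit
    rcases hW.card_eq_three_or i with ⟨r, s, w, hr, hs, hw, hrs, hrw, hsw, hc, hsum⟩ | ⟨hc, h⟩
    · rw [hsum, hsum, hsum, hsum, hsum]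
      have f₁ := fun (u v w' : V) hu hv hw' huv huw hvw hd =>
        hW₁.blocked_of_degIn_le_one (i := i) (a := u) (b := v) (p := w') (x := r) (y := s) (z := w)
          hu hv hw' huv huw hvw hd (by rwa [e₁]) (by rwa [e₁]) (by rwa [e₁]) (by rwa [e₁])
          hrs hrw hsw
      have f₂ := fun (u v w' : V) hu hv hw' huv huw hvw hd =>
        hW₂.blocked_of_degIn_le_one (i := i) (a := u) (b := v) (p := w') (x := r) (y := s) (z := w)
          hu hv hw' huv huw hvw hd (by rwa [e₂]) (by rwa [e₂]) (by rwa [e₂]) (by rwa [e₂])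
          hrs hrw hsw
      exact sum_le_twelve_of_blocked _ _ _ _ _ _ _ _ _
        (hW.blocked_of_degIn_le_one ha hb hp hab hap.ne hbp.ne da.le hc hr hs hw hrs hrw hsw)
        (hW.blocked_of_degIn_le_one hb ha hp hab.symm hbp.ne hap.ne db.le hc
          hr hs hw hrs hrw hsw) _ _ _
        (f₁ x b p hx₁ hb₁ hp₁ hxb.symm hxp.symm hbp.ne dx₁.le)
        (f₁ p b x hp₁ hb₁ hx₁ hbp.ne' hxp hxb dp₁.le) _ _ _
        (f₂ z a p hz₂ ha₂ hp₂ hza.symm hzp.symm hap.ne dz₂.le)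
        (f₂ p a z hp₂ ha₂ hz₂ hap.ne' hzp hza dp₂.le)
    · have hxi : G.degIn (W i) x ≤ 2 := by
        by_contra hlt
        exact hc (e₁ ▸ hW₁.card_eq_three_of_le_degIn (i := i) hx₁ (by rw [e₁]; omega))
      have hzi : G.degIn (W i) z ≤ 2 := by
        by_contra hlt
        exact hc (e₂ ▸ hW₂.card_eq_three_of_le_degIn (i := i) hz₂ (by rw [e₂]; omega))
      have := h a ha
      have := h b hb
      have := h p hp
      omega
  have hs := sum_le_card_nsmul _ _ _ key
  rw [sum_add_distrib, sum_add_distrib, sum_add_distrib, sum_add_distrib, smul_eq_mul,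
    ← mul_sum] at hs
  have hcard := card_erase_add_one (mem_univ t)
  rw [card_univ] at hcard
  have hdeg' (v : V) : 2 * (Fintype.card ι + 1) ≤ G.degIn (rest W) v +
      (∑ i ∈ univ.erase t, G.degIn (W i) v + G.degIn (W t) v) := by
    rw [sum_erase_add _ _ (mem_univ t), ← degIn_univ hW.toIsPacking]
    exact hdeg v
  have hWt : W t = {x, y, z} := by
    refine (eq_of_subset_of_card_le ?_ ?_).symm
    · simp [insert_subset_iff, hx, hy, hz]
    · rw [h3, card_eq_three.2 ⟨x, y, z, hxy, hxz, hyz, rfl⟩]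
  have tp : G.degIn (W t) p = 0 := by
    rw [hWt, degIn_triple hxy hxz hyz]
    simp [hpx, hpy, hpz]
  have ta : G.degIn (W t) a ≤ #(W t) := degIn_le_card
  have tb : G.degIn (W t) b ≤ #(W t) := degIn_le_card
  have tx := degIn_lt_card (G := G) hx
  have tz := degIn_lt_card (G := G) hz
  have g1 := hdeg' a
  have g2 := hdeg' b
  have g3 := hdeg' x
  have g4 := hdeg' z
  have g5 := hdeg' p
  have dz' : G.degIn (rest W) z ≤ 2 := by rw [dz]; split_ifs <;> omega
  omega

theorem IsOptimal.false_of_degIn_eq_three (hW : G.IsOptimal W)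
    (hdeg : ∀ v, 2 * (Fintype.card ι + 1) ≤ G.degIn univ v) (hR : rest W = {a, b, p})
    (hab : a ≠ b) (hap : G.Adj a p) (hbp : G.Adj b p) (hnab : ¬ G.Adj a b)
    (ha3 : G.degIn (W t) a = 3) (hb2 : 2 ≤ G.degIn (W t) b) : False := by
  rcases hW.card_eq_three_or t with ⟨x, y, z, hx, hy, hz, hxy, hxz, hyz, h3, hsum⟩ | ⟨-, h⟩
  · rw [hsum] at ha3 hb2
    have hax : G.Adj a x := by
      by_contra hn
      have h1 := (decide (G.Adj a y)).toNat_le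
      have h2 := (decide (G.Adj a z)).toNat_le
      simp only [hn, decide_false, Bool.toNat_false] at ha3
      omega
    have hay : G.Adj a y := by
      by_contra hn
      have h1 := (decide (G.Adj a x)).toNat_le
      have h2 := (decide (G.Adj a z)).toNat_le
      simp only [hn, decide_false, Bool.toNat_false] at ha3
      omega
    have haz : G.Adj a z := by
      by_contra hn
      have h1 := (decide (G.Adj a x)).toNat_le
      have h2 := (decide (G.Adj a y)).toNat_le
      simp only [hn, decide_false, Bool.toNat_false] at ha3
      omega
    have key {x y z : V} := hW.false_of_adj (t := t) (x := x) (y := y) (z := z) hdeg hR hab hap hbp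
      hnab h3
    by_cases hbx : G.Adj b x
    · by_cases hby : G.Adj b y
      · exact key hx hy hz hxy hxz hyz hax hay haz hbx hby
      · by_cases hbz : G.Adj b z
        · exact key hx hz hy hxz hxy hyz.symm hax haz hay hbx hbz
        · simp [hbx, hby, hbz] at hb2
    · by_cases hby : G.Adj b y
      · by_cases hbz : G.Adj b z
        · exact key hy hz hx hyz hxy.symm hxz.symm hay haz hax hby hbz
        · simp [hbx, hby, hbz] at hb2
      · by_cases hbz : G.Adj b z <;> simp [hbx, hby, hbz] at hb2
  · have := h a (by simp [hR])
    omega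

theorem IsOptimal.exists_isCore (hW : G.IsOptimal W)
    (hdeg : ∀ v, 2 * (Fintype.card ι + 1) ≤ G.degIn univ v) (hcard : 3 ≤ #(rest W)) :
    ∃ T ⊆ rest W, G.IsCore T := by
  by_contra! hno
  obtain ⟨a, ha, b, hb, hab, ha1, hb1, h2⟩ := hW.exists_degIn_eq hdeg hcard hno
  have h3 : #(rest W) = 3 := le_antisymm (hW.card_rest_le_three hdeg ha hb hab ha1 hb1 h2) hcard
  obtain ⟨p, hp⟩ : ∃ p, ((rest W).erase a).erase b = {p} := by
    rw [← card_eq_one, card_erase_of_mem (mem_erase.2 ⟨hab.symm, hb⟩), card_erase_of_mem ha, h3]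
  have hR : rest W = {a, b, p} := by
    rw [← hp, insert_erase (mem_erase.2 ⟨hab.symm, hb⟩), insert_erase ha]
  have hpR : p ∈ ((rest W).erase a).erase b := by simp [hp]
  simp only [mem_erase] at hpR
  obtain ⟨hpb, hpa, hpR⟩ := hpR
  have hp2 := h2 p hpR hpa hpb
  have hdR (v : V) := degIn_triple (G := G) (v := v) hab hpa.symm hpb.symm
  rw [← hR] at hdR
  have hpa' : G.Adj p a := by
    by_contra hn
    rw [hdR] at hp2
    by_cases h : G.Adj p b <;> simp [hn, h] at hp2
  have hpb' : G.Adj p b := by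
    by_contra hn
    rw [hdR] at hp2
    by_cases h : G.Adj p a <;> simp [hn, h] at hp2
  have hnab : ¬ G.Adj a b := by
    intro h
    simp [hdR, h, hpa'.symm] at ha1
  -- More than four edges from the two ends means three from one and at least two from the other,
  -- the excluded configuration. With at most four, the ends lack degree.
  have key : ∀ i ∈ univ, G.degIn (W i) a + G.degIn (W i) b ≤ 4 := by
    intro i _
    by_contra hlt
    have hle : G.degIn (W i) a ≤ 3 ∧ G.degIn (W i) b ≤ 3 := by
      rcases hW.card_eq_three_or i with ⟨x, y, z, -, -, -, -, -, -, hc, -⟩ | ⟨-, h⟩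
      · rw [← hc]
        exact ⟨degIn_le_card, degIn_le_card⟩
      · have := h a ha
        have := h b hb
        omega
    rcases Nat.lt_or_ge (G.degIn (W i) a) 3 with hlt3 | hge
    · exact hW.false_of_degIn_eq_three (t := i) hdeg (hR.trans (insert_comm _ _ _)) hab.symm
        hpb'.symm hpa'.symm (fun h => hnab h.symm) (by omega) (by omega)
    · exact hW.false_of_degIn_eq_three (t := i) hdeg hR hab hpa'.symm hpb'.symm hnab
        (by omega) (by omega)
  have hs := sum_le_card_nsmul _ _ _ key
  rw [sum_add_distrib, smul_eq_mul, card_univ] at hs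
  have g1 := hdeg a
  have g2 := hdeg b
  rw [degIn_univ hW.toIsPacking] at g1 g2
  omega

end CorradiHajnal

end SimpleGraph

/-! ### The Corrádi–Hajnal induction. -/

namespace SimpleGraph

section CorradiHajnal

open Finset
open scoped Classical

variable {V : Type*}

theorem IsCore.of_sup_edge {G : SimpleGraph V} {S : Finset V} {x y : V}
    (h : (G ⊔ edge x y).IsCore S) (hxy : ¬ (x ∈ S ∧ y ∈ S)) : G.IsCore S := by
  refine ⟨h.1, fun v hv => (h.2 v hv).trans (card_le_card fun w hw => ?_)⟩
  simp only [mem_filter, sup_adj, edge_adj] at hw ⊢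
  obtain ⟨hw, h | ⟨⟨rfl, rfl⟩ | ⟨rfl, rfl⟩, -⟩⟩ := hw
  · exact ⟨hw, h⟩
  · exact absurd ⟨hv, hw⟩ hxy
  · exact absurd ⟨hw, hv⟩ hxy

theorem isCore_of_forall_adj {G : SimpleGraph V} {S : Finset V} (h3 : 3 ≤ #S)
    (h : ∀ x ∈ S, ∀ y ∈ S, x ≠ y → G.Adj x y) : G.IsCore S := by
  refine ⟨card_pos.1 (by omega), fun v hv => ?_⟩
  have h1 := card_le_degIn (G := G) (erase_subset v S) fun w hw =>
    h v hv w (mem_of_mem_erase hw) (mem_erase.1 hw).1.symm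
  have h2 := card_erase_add_one hv
  omega

theorem IsPacking.cons [Fintype V] {G : SimpleGraph V} {m : ℕ} {W : Fin m → Finset V}
    (hW : G.IsPacking W) {T : Finset V} (hT : G.IsCore T) (hTW : T ⊆ rest W) :
    G.IsPacking (Fin.cons T W : Fin (m + 1) → Finset V) := by
  have hdis (j : Fin m) : Disjoint T (W j) :=
    Finset.disjoint_left.2 fun v hv => notMem_of_mem_rest (hTW hv)
  refine ⟨fun i => ?_, fun i => ?_⟩
  · cases i using Fin.cases with
    | zero =>
      intro j hj
      cases j using Fin.cases with
      | zero => exact absurd rfl hj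
      | succ j => simpa using hdis j
    | succ i =>
      intro j hj
      cases j using Fin.cases with
      | zero => simpa using (hdis i).symm
      | succ j => simpa using hW.disjoint (fun h => hj (congrArg Fin.succ h))
  · cases i using Fin.cases with
    | zero => simpa using hT
    | succ i => simpa using hW.isCore i

/-- The **Corrádi–Hajnal theorem**. -/
theorem exists_isPacking [Fintype V] (G : SimpleGraph V) (k : ℕ) (hcard : 3 * k ≤ Fintype.card V)
    (hdeg : ∀ v, 2 * k ≤ G.degIn univ v) : ∃ W : Fin k → Finset V, G.IsPacking W := by
  obtain _ | m := k
  · exact ⟨fun _ => ∅, fun i => i.elim0, fun i => i.elim0⟩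
  -- Induction from the complete graph downwards: supergraphs are already settled.
  induction G using WellFoundedGT.induction with
  | ind G ih =>
    by_cases hcomplete : ∀ x y, x ≠ y → G.Adj x y
    · obtain ⟨f⟩ : Nonempty (Fin (m + 1) × Fin 3 ↪ V) :=
        Function.Embedding.nonempty_of_card_le (by simpa [mul_comm] using hcard)
      refine ⟨fun i => univ.image fun j => f (i, j), fun i j hij => ?_, fun i => ?_⟩
      · simp only [Finset.disjoint_left]
        simp only [mem_image, mem_univ, true_and, not_exists]
        rintro _ ⟨a, rfl⟩ b hb
        have := f.injective hb
        simp only [Prod.mk.injEq] at this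
        exact hij this.1.symm
      · refine isCore_of_forall_adj ?_ fun x _ y _ => hcomplete x y
        rw [card_image_of_injective _ fun a b hab => by simpa using f.injective hab]
        simp
    push Not at hcomplete
    obtain ⟨x, y, hxy, hnadj⟩ := hcomplete
    have hle : G ≤ G ⊔ edge x y := le_sup_left
    obtain ⟨W, hW⟩ := ih (G ⊔ edge x y) (lt_of_le_of_ne hle fun h => hnadj (by
      rw [h, sup_adj, edge_adj]
      exact Or.inr ⟨Or.inl ⟨rfl, rfl⟩, hxy⟩)) fun v => (hdeg v).trans
        (degIn_mono_left hle)
    by_cases hall : ∀ i, G.IsCore (W i)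
    · exact ⟨W, hW.disjoint, hall⟩
    push Not at hall
    obtain ⟨i, hi⟩ := hall
    have hxyi : x ∈ W i ∧ y ∈ W i := by
      by_contra h
      exact hi ((hW.isCore i).of_sup_edge h)
    -- Only `W i` can use the added edge. The other members survive in `G`, and `W i` guarantees
    -- three uncovered vertices.
    have hW' : G.IsPacking fun j => W (i.succAbove j) := by
      refine ⟨fun j l hjl => hW.disjoint (i.succAbove_right_injective.ne hjl),
        fun j => (hW.isCore _).of_sup_edge fun h => ?_⟩
      exact Finset.disjoint_left.1 (hW.disjoint (i.succAbove_ne j)) h.1 hxyi.1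
    obtain ⟨W₁, hW₁, hcard₁⟩ := hW'.exists_isOptimal
    have hsub : W i ⊆ rest fun j => W (i.succAbove j) := by
      intro v hv
      rw [mem_rest]
      exact fun j hj => Finset.disjoint_left.1 (hW.disjoint (i.succAbove_ne j)) hj hv
    obtain ⟨T, hT, hTc⟩ := hW₁.exists_isCore (by simpa using hdeg)
      ((hW.isCore i).three_le_card.trans ((card_le_card hsub).trans hcard₁))
    exact ⟨_, hW₁.toIsPacking.cons hTc hT⟩

end CorradiHajnal

end SimpleGraph

/-! ### From cores to cycles. -/

namespace SimpleGraph

/-- A core contains the vertices of a cycle of length at least three. -/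
theorem IsCore.exists_cyclic_sequence {V : Type*} {H : SimpleGraph V} {W : Finset V}
    (hW : H.IsCore W) : ∃ (n : ℕ) (f : Fin (n + 3) → V), Function.Injective f ∧
      (∀ i, f i ∈ W) ∧ ∀ i, H.Adj (f i) (f (i + 1)) := by
  classical
  have hnext : ∀ u v, ∃ w, v ∈ W → w ∈ W ∧ H.Adj v w ∧ w ≠ u := by
    intro u v
    by_cases hv : v ∈ W
    · obtain ⟨w, hw, hwu⟩ := Finset.exists_mem_ne (hW.2 v hv) u
      rw [Finset.mem_filter] at hw
      exact ⟨w, fun _ => ⟨hw.1, hw.2, hwu⟩⟩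
    · exact ⟨v, fun h => absurd h hv⟩
  choose next hnext using hnext
  obtain ⟨v, hv⟩ := hW.1
  -- A walk recorded as (previous, current) that never turns straight back; the initial previous
  -- vertex is immaterial.
  let s : ℕ → V × V := fun n => (fun p : V × V => (p.2, next p.1 p.2))^[n] (v, v)
  have hs (n : ℕ) : s (n + 1) = ((s n).2, next (s n).1 (s n).2) :=
    Function.iterate_succ_apply' _ _ _
  let x : ℕ → V := fun n => (s n).2
  have hxW (n : ℕ) : x n ∈ W := by
    induction n with
    | zero => exact hv
    | succ n ih =>
      change (s (n + 1)).2 ∈ W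
      rw [hs]
      exact (hnext _ _ ih).1
  have hadj (n : ℕ) : H.Adj (x n) (x (n + 1)) := by
    change H.Adj (x n) (s (n + 1)).2
    rw [hs]
    exact (hnext _ _ (hxW n)).2.1
  have hne (n : ℕ) : x (n + 2) ≠ x n := by
    have h := (hnext (s (n + 1)).1 (s (n + 1)).2 (hxW (n + 1))).2.2
    change (s (n + 1 + 1)).2 ≠ (s n).2
    rw [hs (n + 1)]
    refine h.trans_eq ?_
    rw [hs n]
  have hrep : ∃ d, 0 < d ∧ ∃ i, x i = x (i + d) := by
    obtain ⟨i, j, hij, h⟩ := Finite.exists_ne_map_eq_of_infinite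
      (fun n => (⟨x n, hxW n⟩ : (W : Set V)))
    have h : x i = x j := congrArg Subtype.val h
    rcases lt_or_gt_of_ne hij with hlt | hlt
    · exact ⟨j - i, by omega, i, by rw [h]; congr 1; omega⟩
    · exact ⟨i - j, by omega, j, by rw [← h]; congr 1; omega⟩
  -- The shortest gap between equal terms, over all starting points, bounds a segment without
  -- repetition. Gap 1 contradicts adjacency, gap 2 the ban on turning back.
  obtain ⟨hpos, i, hi⟩ := Nat.find_spec hrep
  have hmin := fun d => Nat.find_min (H := hrep) (m := d)
  obtain ⟨n, hn⟩ : ∃ n, Nat.find hrep = n + 3 := by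
    refine ⟨Nat.find hrep - 3, ?_⟩
    have h1 : Nat.find hrep ≠ 1 := fun h => (hadj i).ne (by rw [hi, h])
    have h2 : Nat.find hrep ≠ 2 := fun h => hne i (by rw [hi, h])
    omega
  rw [hn] at hi
  have haux : ∀ a b : ℕ, a < b → b < n + 3 → x (i + a) ≠ x (i + b) := by
    intro a b hab hb h
    refine hmin (b - a) (by omega) ⟨by omega, i + a, ?_⟩
    rw [h]
    congr 1
    omega
  refine ⟨n, fun j => x (i + j), fun a b hab => ?_, fun j => hxW _, fun j => ?_⟩
  · by_contra hne'
    rcases lt_or_gt_of_ne hne' with hlt | hlt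
    · exact haux a b hlt b.2 hab
    · exact haux b a hlt a.2 hab.symm
  · by_cases hj : j = Fin.last (n + 2)
    · subst hj
      have := hadj (i + (n + 2))
      rw [show i + (n + 2) + 1 = i + (n + 3) by ring, ← hi] at this
      simpa using this
    · have := hadj (i + j)
      rwa [add_assoc, ← Fin.val_add_one_of_lt (Fin.lt_last_iff_ne_last.2 hj)] at this

end SimpleGraph

/-! ### Cycles from loops, parallel edges and cores. -/

namespace Graph

open Set

variable {α β : Type*} {G : Graph α β}

theorem exists_cycle_of_isCore {S : Set α} {H : SimpleGraph S}
    (hH : ∀ x y, H.Adj x y → G.Adj x.1 y.1) {W : Finset S} (hW : H.IsCore W) :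
    ∃ C : G.Cycle, range C.vert ⊆ Subtype.val '' (W : Set S) := by
  obtain ⟨n, f, hf, hfW, hadj⟩ := hW.exists_cyclic_sequence
  choose e he using fun i => hH _ _ (hadj i)
  have hf' : Function.Injective fun i => (f i).1 := Subtype.val_injective.comp hf
  refine ⟨⟨n + 3, fun i => (f i).1, e, hf', fun i j hij => ?_, he⟩, ?_⟩
  · have h := he i
    rw [hij] at h
    rcases h.eq_and_eq_or_eq_and_eq (he j) with ⟨h1, -⟩ | ⟨h1, h2⟩
    · exact hf' h1
    · have h1 := hf' h1
      have h2 := hf' h2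
      -- An edge traversed twice in opposite directions would give `2 = 0` in `Fin (n + 3)`.
      rw [h1, add_assoc, add_eq_left] at h2
      simp [Fin.ext_iff, Fin.val_add, Nat.mod_eq_of_lt] at h2
  · rintro _ ⟨i, rfl⟩
    exact ⟨f i, hfW i, rfl⟩

theorem IsLoopAt.exists_cycle {e : β} {v : α} (h : G.IsLoopAt e v) :
    ∃ C : G.Cycle, range C.vert = {v} :=
  ⟨⟨1, fun _ => v, fun _ => e, Function.injective_of_subsingleton _,
    Function.injective_of_subsingleton _, fun _ => h⟩, range_const⟩

theorem exists_cycle_of_isLink_of_isLink {e f : β} {x y : α} (hxy : x ≠ y) (hef : e ≠ f)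
    (he : G.IsLink e x y) (hf : G.IsLink f x y) :
    ∃ C : G.Cycle, range C.vert = {x, y} := by
  refine ⟨⟨2, ![x, y], ![e, f], ?_, ?_, ?_⟩, by simp [pair_comm]⟩
  · intro i j
    fin_cases i <;> fin_cases j <;> simp [hxy, hxy.symm]
  · intro i j
    fin_cases i <;> fin_cases j <;> simp [hef, hef.symm]
  · intro i
    fin_cases i
    · simpa using he
    · simpa using hf.symm

theorem Cycle.exists_isLoopAt (C : G.Cycle) (h : C.length = 1) :
    ∃ v ∈ range C.vert, v ∈ G.loopVertices := by
  obtain ⟨n, vert, edge, _, _, hl⟩ := C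
  dsimp only at h
  subst h
  exact ⟨vert 0, mem_range_self 0, edge 0, hl 0⟩

theorem Cycle.exists_parallel (C : G.Cycle) (h : C.length = 2) :
    ∃ x y, range C.vert = {x, y} ∧ x ≠ y ∧ ∃ e f, e ≠ f ∧ G.IsLink e x y ∧ G.IsLink f x y := by
  obtain ⟨n, vert, edge, hv, he, hl⟩ := C
  dsimp only at h
  subst h
  refine ⟨vert 0, vert 1, ?_, hv.ne (by simp), edge 0, edge 1, he.ne (by simp), hl 0,
    (hl 1).symm⟩
  ext v
  simp [Fin.exists_fin_two, eq_comm]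

theorem Cycle.range_vert_subset (C : G.Cycle) : range C.vert ⊆ G.vertexSet := by
  rintro _ ⟨i, rfl⟩
  exact (C.isLink i).left_mem

theorem Cycle.ncard_range_vert (C : G.Cycle) : (range C.vert).ncard = C.length := by
  rw [ncard_range_of_injective C.vert_injective, Nat.card_eq_fintype_card, Fintype.card_fin]

theorem loopVertices_subset : G.loopVertices ⊆ G.vertexSet := fun _ ⟨_, he⟩ => he.vertex_mem

/-- `G` has a family of pairwise disjoint cycles indexed by `ι` with vertices in `S`. -/
def HasDisjointCyclesIn (G : Graph α β) (ι : Type*) (S : Set α) : Prop :=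
  ∃ C : ι → G.Cycle, (Pairwise fun i j => Disjoint (range (C i).vert) (range (C j).vert)) ∧
    ∀ i, range (C i).vert ⊆ S

theorem HasDisjointCyclesIn.sum {ι κ : Type*} {S T : Set α} (hS : G.HasDisjointCyclesIn ι S)
    (hT : G.HasDisjointCyclesIn κ T) (hST : Disjoint S T) :
    G.HasDisjointCyclesIn (ι ⊕ κ) (S ∪ T) := by
  obtain ⟨C, hC, hCS⟩ := hS
  obtain ⟨D, hD, hDT⟩ := hT
  refine ⟨Sum.elim C D, ?_, ?_⟩
  · rintro (i | i) (j | j) hij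
    · exact hC fun h => hij (congrArg _ h)
    · exact hST.mono (hCS i) (hDT j)
    · exact (hST.mono (hCS j) (hDT i)).symm
    · exact hD fun h => hij (congrArg _ h)
  · rintro (i | i)
    · exact (hCS i).trans subset_union_left
    · exact (hDT i).trans subset_union_right

theorem HasDisjointCyclesIn.hasDisjointCycles {ι : Type*} [Finite ι] {S : Set α} {k : ℕ}
    (h : G.HasDisjointCyclesIn ι S) (hk : k ≤ Nat.card ι) : G.HasDisjointCycles k := by
  obtain ⟨C, hC, -⟩ := h
  have := Fintype.ofFinite ι
  obtain ⟨f⟩ : Nonempty (Fin k ↪ ι) :=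
    Function.Embedding.nonempty_of_card_le (by simpa [Nat.card_eq_fintype_card] using hk)
  exact ⟨fun i => C (f i), fun i j hij => hC (f.injective.ne hij)⟩

theorem hasDisjointCyclesIn_loopVertices (G : Graph α β) :
    G.HasDisjointCyclesIn G.loopVertices G.loopVertices := by
  choose C hC using fun v : G.loopVertices => v.2.choose_spec.exists_cycle
  refine ⟨C, fun v w hvw => ?_, fun v => ?_⟩
  · simp only [hC, disjoint_singleton]
    exact fun h => hvw (Subtype.ext h)
  · rw [hC, singleton_subset_iff]
    exact v.2

theorem strongGraph_adj {x y : α} : G.strongGraph.Adj x y ↔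
    x ≠ y ∧ (x ∉ G.loopVertices ∧ y ∉ G.loopVertices) ∧
      ∃ e f, e ≠ f ∧ G.IsLink e x y ∧ G.IsLink f x y := by
  simp only [strongGraph, multipleEdgeGraph, deleteVerts_isLink]
  constructor
  · rintro ⟨h, e, f, hef, ⟨he, hx, hy⟩, hf, -⟩
    exact ⟨h, ⟨hx, hy⟩, e, f, hef, he, hf⟩
  · rintro ⟨h, ⟨hx, hy⟩, e, f, hef, he, hf⟩
    exact ⟨h, e, f, hef, ⟨he, hx, hy⟩, hf, hx, hy⟩

theorem verts_subset_of_isMatching {M : G.strongGraph.Subgraph} (hM : M.IsMatching) :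
    M.verts ⊆ G.vertexSet \ G.loopVertices := by
  intro v hv
  obtain ⟨w, hw, -⟩ := hM hv
  obtain ⟨-, ⟨hv, -⟩, e, -, -, he, -⟩ := strongGraph_adj.1 hw.adj_sub
  exact ⟨he.left_mem, hv⟩

theorem hasDisjointCyclesIn_edgeSet {M : G.strongGraph.Subgraph} (hM : M.IsMatching) :
    G.HasDisjointCyclesIn M.edgeSet M.verts := by
  have h : ∀ e : M.edgeSet, ∃ C : G.Cycle, range C.vert = {v | v ∈ e.1} := by
    rintro ⟨e, he⟩
    induction e with
    | h x y =>
      obtain ⟨hxy, -, e, f, hef, h1, h2⟩ := strongGraph_adj.1 (M.mem_edgeSet.1 he).adj_sub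
      obtain ⟨C, hC⟩ := exists_cycle_of_isLink_of_isLink hxy hef h1 h2
      exact ⟨C, by rw [hC]; ext; simp⟩
  choose C hC using h
  refine ⟨C, fun e f hef => ?_, fun e => ?_⟩
  · simp only [hC, Set.disjoint_left]
    intro v hve hvf
    refine hef (Subtype.ext ?_)
    obtain ⟨x, hx⟩ := Sym2.mem_iff_exists.1 hve
    obtain ⟨y, hy⟩ := Sym2.mem_iff_exists.1 hvf
    have h1 := e.2
    have h2 := f.2
    rw [hx, SimpleGraph.Subgraph.mem_edgeSet] at h1
    rw [hy, SimpleGraph.Subgraph.mem_edgeSet] at h2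
    rw [hx, hy, hM.eq_of_adj_left h1 h2]
  · rw [hC]
    exact fun v hv => SimpleGraph.Subgraph.mem_verts_of_mem_edge e.2 hv

end Graph

/-! ### Sizes of matchings. -/

namespace SimpleGraph.Subgraph

variable {V : Type*} {F : SimpleGraph V} {M : F.Subgraph}

theorem IsMatching.ncard_edgeSet_le (hM : M.IsMatching) (hfin : M.verts.Finite) :
    M.edgeSet.Finite ∧ M.edgeSet.ncard ≤ M.verts.ncard := by
  have := hfin.to_subtype
  exact ⟨Finite.of_surjective _ (IsMatching.toEdge.surjective hM),
    Nat.card_le_card_of_surjective _ (IsMatching.toEdge.surjective hM)⟩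

theorem IsMatching.ncard_verts_le (hM : M.IsMatching) (hfin : M.edgeSet.Finite) :
    M.verts.ncard ≤ 2 * M.edgeSet.ncard := by
  classical
  have h : M.verts ⊆ (hfin.toFinset.biUnion Sym2.toFinset : Finset V) := by
    intro v hv
    obtain ⟨w, hw, -⟩ := hM hv
    simp only [Finset.coe_biUnion, Set.mem_iUnion, Finset.mem_coe, Sym2.mem_toFinset,
      Set.Finite.mem_toFinset]
    exact ⟨s(v, w), hw, by simp⟩
  refine (Set.ncard_le_ncard h (Finset.finite_toSet _)).trans ?_
  rw [Set.ncard_coe_finset, Set.ncard_eq_toFinset_card _ hfin, mul_comm]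
  refine Finset.card_biUnion_le_card_mul _ _ _ fun e _ => ?_
  rw [Sym2.card_toFinset]
  split_ifs <;> omega

end SimpleGraph.Subgraph

/-! ### The two directions of the criterion. -/

namespace Graph

open Set

variable {α β : Type*} {G : Graph α β}

/-- Without a bound, `sSup` on `ℕ` would return the default value 0 rather than a maximum. -/
theorem bddAbove_matching (hV : G.vertexSet.Finite) : BddAbove {n | ∃ M : G.strongGraph.Subgraph,
    M.IsMatching ∧ M.edgeSet.Finite ∧ M.edgeSet.ncard = n} := by
  refine ⟨G.vertexSet.ncard, ?_⟩
  rintro _ ⟨M, hM, -, rfl⟩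
  have h := (verts_subset_of_isMatching hM).trans sdiff_subset
  exact (hM.ncard_edgeSet_le (hV.subset h)).2.trans (ncard_le_ncard h hV)

theorem exists_isMatching_ncard_eq (hV : G.vertexSet.Finite) : ∃ M : G.strongGraph.Subgraph,
    M.IsMatching ∧ M.edgeSet.Finite ∧ M.edgeSet.ncard = G.strongGraph.matchingNumber :=
  Nat.sSup_mem (s := {n | ∃ M : G.strongGraph.Subgraph,
    M.IsMatching ∧ M.edgeSet.Finite ∧ M.edgeSet.ncard = n})
    ⟨0, ⊥, fun _ h => h.elim, by simp, by simp⟩ (bddAbove_matching hV)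

/-- The bound is sufficient: use all loops, a maximum matching of multiple edges, and the
Corrádi–Hajnal theorem in what remains. -/
theorem hasDisjointCycles_of_le (hV : G.vertexSet.Finite) {k : ℕ}
    (hdeg : ∀ v ∈ G.vertexSet, 2 * k ≤ G.simpleDegree v)
    (h : 3 * k ≤ G.vertexSet.ncard + 2 * G.loopVertices.ncard + G.strongGraph.matchingNumber) :
    G.HasDisjointCycles k := by
  classical
  obtain ⟨M, hM, hMfin, hMcard⟩ := exists_isMatching_ncard_eq hV
  rw [← hMcard] at h
  have hMV := verts_subset_of_isMatching hM
  have hLfin : G.loopVertices.Finite := hV.subset loopVertices_subset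
  have hMvfin : M.verts.Finite := hV.subset (hMV.trans sdiff_subset)
  have hMv := hM.ncard_verts_le hMfin
  set S : Set α := G.vertexSet \ (G.loopVertices ∪ M.verts)
  have hSfin : S.Finite := hV.subset sdiff_subset
  have : Fintype S := hSfin.fintype
  have hU := ncard_union_le G.loopVertices M.verts
  have hUfin := hLfin.union hMvfin
  have hScard : G.vertexSet.ncard ≤ Fintype.card S + (G.loopVertices ∪ M.verts).ncard := by
    rw [← Nat.card_eq_fintype_card, Nat.card_coe_set_eq]
    refine (ncard_le_ncard ?_ (hSfin.union hUfin)).trans (ncard_union_le _ _)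
    intro v hv
    by_cases hvU : v ∈ G.loopVertices ∪ M.verts
    · exact Or.inr hvU
    · exact Or.inl ⟨hv, hvU⟩
  let H : SimpleGraph S :=
    { Adj := fun x y => x ≠ y ∧ G.Adj x.1 y.1
      symm := ⟨fun _ _ h => ⟨h.1.symm, h.2.symm⟩⟩
      loopless := ⟨fun _ h => h.1 rfl⟩ }
  have hHdeg : ∀ v : S, G.simpleDegree v ≤
      H.degIn Finset.univ v + (G.loopVertices ∪ M.verts).ncard := by
    intro v
    let A : Finset S := {w | H.Adj v w}
    have hA : H.degIn Finset.univ v = (Subtype.val '' (A : Set S)).ncard := by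
      rw [ncard_image_of_injective _ Subtype.val_injective, ncard_coe_finset]
      simp only [SimpleGraph.degIn, A]
      congr
    rw [hA]
    refine (ncard_le_ncard ?_ ((toFinite _).union hUfin)).trans (ncard_union_le _ _)
    rintro w ⟨hwv, hw⟩
    by_cases hwU : w ∈ G.loopVertices ∪ M.verts
    · exact Or.inr hwU
    · refine Or.inl ⟨⟨w, hw.right_mem, hwU⟩, ?_, rfl⟩
      simp only [A, Finset.coe_filter, Finset.mem_univ, true_and, mem_ofPred_eq]
      exact ⟨fun h => hwv (congrArg Subtype.val h).symm, hw⟩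
  -- If the truncated difference is 0, loops and matching edges already suffice; otherwise losing at
  -- most $|V_1| + 2\alpha'$ vertices leaves enough degree and order.
  obtain ⟨W, hW⟩ := H.exists_isPacking (k - G.loopVertices.ncard - M.edgeSet.ncard) (by omega)
    fun v => by
      have h1 := hdeg v v.2.1
      have h2 := hHdeg v
      omega
  choose C hC using fun i => exists_cycle_of_isCore (G := G) (H := H) (fun x y h => h.2) (hW.isCore i)
  have hin : G.HasDisjointCyclesIn (Fin (k - G.loopVertices.ncard - M.edgeSet.ncard)) S := by
    refine ⟨C, fun i j hij => ?_, fun i => (hC i).trans ?_⟩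
    · refine Disjoint.mono (hC i) (hC j) ?_
      rw [disjoint_image_iff Subtype.val_injective, Finset.disjoint_coe]
      exact hW.disjoint hij
    · rintro _ ⟨v, -, rfl⟩
      exact v.2
  have hall := ((hasDisjointCyclesIn_loopVertices G).sum (hasDisjointCyclesIn_edgeSet hM)
    (disjoint_left.2 fun v hv hvM => (hMV hvM).2 hv)).sum hin
    (disjoint_left.2 fun v hv hvS => hvS.2 hv)
  have := hLfin.to_subtype
  have := hMfin.to_subtype
  refine hall.hasDisjointCycles ?_
  rw [Nat.card_sum, Nat.card_sum, Nat.card_coe_set_eq, Nat.card_coe_set_eq, Nat.card_fin]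
  omega

/-- Disjoint cycles of length two avoiding $V_1$ are themselves a matching of strong edges. -/
theorem card_le_matchingNumber (hV : G.vertexSet.Finite) {ι : Type*} [Finite ι] (C : ι → G.Cycle)
    (hC : Pairwise fun i j => Disjoint (range (C i).vert) (range (C j).vert))
    (h2 : ∀ i, (C i).length = 2) (hL : ∀ i, Disjoint (range (C i).vert) G.loopVertices) :
    Nat.card ι ≤ G.strongGraph.matchingNumber := by
  choose x y hxy hne e f hef he hf using fun i => (C i).exists_parallel (h2 i)
  have hadj (i : ι) : G.strongGraph.Adj (x i) (y i) := by
    have := disjoint_left.1 (hL i)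
    exact strongGraph_adj.2 ⟨hne i, ⟨this (by simp [hxy]), this (by simp [hxy])⟩,
      e i, f i, hef i, he i, hf i⟩
  have hinj : Function.Injective fun i => s(x i, y i) := by
    intro i j hij
    by_contra hne'
    have h1 : x i ∈ s(x j, y j) := by
      rw [← show s(x i, y i) = s(x j, y j) from hij]
      simp
    exact disjoint_left.1 (hC hne') (show x i ∈ _ by simp [hxy]) (by simpa [hxy] using h1)
  have hedge : (⨆ i, G.strongGraph.subgraphOfAdj (hadj i)).edgeSet
      = range fun i => s(x i, y i) := by
    ext e
    simp [SimpleGraph.Subgraph.edgeSet_iSup, eq_comm]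
  refine le_csSup (bddAbove_matching hV)
    ⟨⨆ i, G.strongGraph.subgraphOfAdj (hadj i), ?_, ?_, ?_⟩
  · refine SimpleGraph.Subgraph.IsMatching.iSup (fun i => .subgraphOfAdj _) fun i j hij => ?_
    simp only [SimpleGraph.support_subgraphOfAdj, ← hxy]
    exact hC hij
  · rw [hedge]
    exact finite_range _
  · rw [hedge, ncard_range_of_injective hinj]

/-- The bound is necessary, without any assumption on degrees. -/
theorem HasDisjointCycles.le (hV : G.vertexSet.Finite) {k : ℕ} (h : G.HasDisjointCycles k) :
    3 * k ≤ G.vertexSet.ncard + 2 * G.loopVertices.ncard + G.strongGraph.matchingNumber := by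
  classical
  obtain ⟨C, hC⟩ := h
  have hLfin : G.loopVertices.Finite := hV.subset loopVertices_subset
  let A : Finset (Fin k) := {i | ¬ Disjoint (range (C i).vert) G.loopVertices}
  let B : Finset (Fin k) := {i | Disjoint (range (C i).vert) G.loopVertices ∧ (C i).length = 2}
  have hA : A.card ≤ G.loopVertices.ncard := by
    have hA' : ∀ i : A, ∃ v ∈ range (C i).vert, v ∈ G.loopVertices := fun i => by
      have := (Finset.mem_filter.1 i.2).2
      rwa [not_disjoint_iff] at this
    choose v hv hvL using hA'
    have := hLfin.to_subtype
    have hinj : Function.Injective fun i => (⟨v i, hvL i⟩ : G.loopVertices) := by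
      intro i j hij
      by_contra hne
      have hij : v i = v j := congrArg Subtype.val hij
      exact disjoint_left.1 (hC fun h => hne (Subtype.ext h)) (hv i) (hij ▸ hv j)
    have := Nat.card_le_card_of_injective _ hinj
    simpa [Nat.card_coe_set_eq] using this
  have hB : B.card ≤ G.strongGraph.matchingNumber := by
    have := card_le_matchingNumber hV (fun i : B => C i)
      (fun i j hij => hC fun h => hij (Subtype.ext h))
      (fun i => (Finset.mem_filter.1 i.2).2.2) (fun i => (Finset.mem_filter.1 i.2).2.1)
    simpa using this
  have hlen : ∑ i, (C i).length ≤ G.vertexSet.ncard := by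
    have h1 : (⋃ i, range (C i).vert).ncard = ∑ i, (C i).length := by
      rw [ncard_iUnion_of_finite (fun i => finite_range _) hC, finsum_eq_sum_of_fintype]
      exact Finset.sum_congr rfl fun i _ => (C i).ncard_range_vert
    rw [← h1]
    exact ncard_le_ncard (iUnion_subset fun i => (C i).range_vert_subset) hV
  -- Only cycles meeting $V_1$ can have length 1, so weight 2 for `A` and 1 for `B` lifts every
  -- cycle to at least 3.
  have hsum : ∑ _i : Fin k, 3 ≤ ∑ i, ((C i).length + (if i ∈ A then 2 else 0)
      + (if i ∈ B then 1 else 0)) := by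
    refine Finset.sum_le_sum fun i _ => ?_
    have h0 := (C i).length_ne_zero.ne
    by_cases hd : Disjoint (range (C i).vert) G.loopVertices
    · have h1 : (C i).length ≠ 1 := by
        intro h1
        obtain ⟨v, hv, hvL⟩ := (C i).exists_isLoopAt h1
        exact disjoint_left.1 hd hv hvL
      by_cases h2 : (C i).length = 2
      · have : i ∈ B := by simp [B, hd, h2]
        simp [this, h2]
      · omega
    · have : i ∈ A := by simp [A, hd]
      simp only [this, if_true]
      omega
  simp only [Finset.sum_add_distrib, Finset.sum_ite_mem, Finset.univ_inter, Finset.sum_const,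
    Finset.card_univ, Fintype.card_fin, smul_eq_mul] at hsum
  omega

end Graph

theorem theorem2p2 {α β : Type*} (G : Graph α β) (hV : G.vertexSet.Finite)
    (k : ℕ) (hk : 1 ≤ k) (hdeg : ∀ v ∈ G.vertexSet, 2 * k ≤ G.simpleDegree v) :
    (¬ G.HasDisjointCycles k ↔
      (G.vertexSet.ncard : ℤ) - (G.loopVertices.ncard : ℤ)
          - 2 * (G.strongGraph.matchingNumber : ℤ)
        < 3 * ((k : ℤ) - (G.loopVertices.ncard : ℤ) - (G.strongGraph.matchingNumber : ℤ))) ∧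
    (¬ G.HasDisjointCycles k ↔
      G.vertexSet.ncard + 2 * G.loopVertices.ncard + G.strongGraph.matchingNumber < 3 * k) := by
  have h : G.HasDisjointCycles k ↔
      3 * k ≤ G.vertexSet.ncard + 2 * G.loopVertices.ncard + G.strongGraph.matchingNumber :=
    ⟨fun h => h.le hV, Graph.hasDisjointCycles_of_le hV hdeg⟩
  rw [h]
  constructor <;> omega
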